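/- Let $n\ge 1$ and let $$B(z)=\gamma\prod_{j=1}^{n}\frac{z-a_j}{1-\overline{a_j}z},\qquad |\gamma|=1,\quad a_1,\dots,a_n\in\mathbb{D},$$ be a Blaschke product of degree $n$ with exactly one critical value; that is, the set $\{w\in\mathbb{D}:\ w=B(z)\text{ and }B'(z)=0\text{ for some }z\in\mathbb{D}\}$ consists of exactly one point. Then $B$ has an elliptical Blaschke curve. Here a Blaschke curve of $B$ is a closed convex curve $\mathcal{C}$ contained in the open unit disk $\mathbb{D}$ (in degenerate cases, a single point) such that for every $\lambda$ on the unit circle $\mathbb{T}$ the convex polygon whose vertices are the solutions $z\in\mathbb{T}$ of $B(z)=\lambda$ is circumscribed about $\mathcal{C}$ (it contains $\mathcal{C}$, and each of its sides is tangent to $\mathcal{C}$ at exactly one point), and such that every point of $\mathcal{C}$ is the point of tangency of a side of such a polygon. "Elliptical" means that $\mathcal{C}$ is a nondegenerate ellipse (possibly a circle) if $n\ge 3$, and a single point (a degenerate ellipse) if $n=2$, where the polygons are chords of $\mathbb{T}$. (For $n=1$ there is no critical value.) -/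

import Mathlib

open scoped ComplexConjugate

/-- The finite Blaschke product `γ ∏ⱼ (z - aⱼ) / (1 - conj aⱼ z)`. It has degree `n`, and is a genuine
Blaschke product when `‖γ‖ = 1` and `‖a j‖ < 1` for all `j`. -/
noncomputable def blaschkeProduct {n : ℕ} (γ : ℂ) (a : Fin n → ℂ) (z : ℂ) : ℂ :=
  γ * ∏ j, (z - a j) / (1 - conj (a j) * z)

/-- The critical values of `B` in the open unit disk: the values of `B` at the points of the disk
where the derivative of `B` vanishes. -/
def criticalValues (B : ℂ → ℂ) : Set ℂ :=
  {w | w ∈ Metric.ball (0 : ℂ) 1 ∧ ∃ z ∈ Metric.ball (0 : ℂ) 1, deriv B z = 0 ∧ B z = w}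

/-- The points of the unit circle that `B` maps to `l`. -/
def circleFiber (B : ℂ → ℂ) (l : ℂ) : Set ℂ :=
  {z | ‖z‖ = 1 ∧ B z = l}

/-- For a set `V` of points of the unit circle: `[z, w]` is a side, run through counterclockwise, of
the convex polygon with vertex set `V`. That is, `z` and `w` are distinct vertices and the polygon
lies in the closed half-plane to the left of the line from `z` to `w`. -/
def IsPolygonSide (V : Set ℂ) (z w : ℂ) : Prop :=
  z ∈ V ∧ w ∈ V ∧ z ≠ w ∧ ∀ v ∈ V, 0 ≤ (conj (w - z) * (v - z)).im

/-- The segment `[z, w]` is tangent to `C` at `p`: it meets `C` at `p` and nowhere else, and every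
tangent vector to `C` at `p` is parallel to `w - z`. -/
def SegmentTangentAt (C : Set ℂ) (z w p : ℂ) : Prop :=
  C ∩ segment ℝ z w = {p} ∧ ∀ v ∈ tangentConeAt ℝ C p, ∃ t : ℝ, v = t * (w - z)

/-- `C` is a Blaschke curve of `B`: a closed convex curve in the open unit disk (which may be
degenerate, that is, a single point) that is inscribed in each of the convex polygons with vertices
at the solutions on the unit circle of `B z = l`, `‖l‖ = 1`, and each point of which is a point of
tangency with a side of such a polygon. -/
structure IsBlaschkeCurve (B : ℂ → ℂ) (C : Set ℂ) : Prop where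
  /-- `C` is a closed convex curve or a point. -/
  convex_curve : ∃ K : Set ℂ, K.Nonempty ∧ IsCompact K ∧ Convex ℝ K ∧ C = frontier K
  /-- `C` lies in the open unit disk. -/
  subset_disk : C ⊆ Metric.ball (0 : ℂ) 1
  /-- `C` lies in every one of the polygons. -/
  subset_polygon : ∀ l : ℂ, ‖l‖ = 1 → C ⊆ convexHull ℝ (circleFiber B l)
  /-- Every side of every one of the polygons is tangent to `C`. -/
  side_tangent : ∀ l : ℂ, ‖l‖ = 1 → ∀ z w : ℂ, IsPolygonSide (circleFiber B l) z w →
    ∃ p, SegmentTangentAt C z w p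
  /-- Every point of `C` is a point of tangency. -/
  point_of_tangency : ∀ p ∈ C, ∃ l : ℂ, ‖l‖ = 1 ∧ ∃ z w : ℂ,
    IsPolygonSide (circleFiber B l) z w ∧ SegmentTangentAt C z w p

/-- A nondegenerate ellipse in the plane, given by its foci and the sum of the distances to them
(circles are included). -/
def IsEllipse (E : Set ℂ) : Prop :=
  ∃ (f g : ℂ) (s : ℝ), dist f g < s ∧ E = {z | dist z f + dist z g = s}

/-! Let `w` be the critical value. Composing `B` with the automorphism that sends `w` to `0` gives a
Blaschke product of degree `n` with zeros `b j` (`exists_blaschke_shift`). If two of these zeros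
differed, its logarithmic derivative would vanish at a point of the disk that is not a zero
(`exists_root_sum_div`), and `B` would have a critical value other than `w` there. So all zeros
equal one point `c`, and up to automorphisms on both sides `B` is the power `z ^ n`
(`exists_shift_eq_pow`). Hence `diskMobius c` carries the fibers of `B` on the unit circle to vertex
sets of regular `n`-gons (`exists_fiber_iff_pow`).

A disk automorphism bends chords, but on the unit circle it agrees with a projective map of the
plane, `projNum c / projDenom c` (the same isometry in the Klein model), which keeps chords
straight. All the regular `n`-gons are circumscribed about the circle of radius `cos (π / n)`. Its
preimage under the projective map is the conic `conicForm δ c = 0` with `δ = sin (π / n) ^ 2`, which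
is therefore inscribed in every polygon of `B`. Containment comes from `convexHull_projMap`,
tangency from the perfect square in `conicForm_chord`. The conic lies inside the disk, so it is an
ellipse (`isEllipse_conicForm`); for `n = 2` the radius is `0` and the conic is a point. -/

/-- The disk automorphism `z ↦ (z - c) / (1 - conj c z)`. -/
noncomputable def diskMobius (c z : ℂ) : ℂ := (z - c) / (1 - conj c * z)

/-! ### Moduli of disk automorphisms. -/

theorem one_sub_conj_mul_ne_zero {c z : ℂ} (hc : ‖c‖ < 1) (hz : ‖z‖ ≤ 1) : 1 - conj c * z ≠ 0 := by
  intro h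
  have h1 : conj c * z = 1 := (sub_eq_zero.mp h).symm
  have h2 : ‖c‖ * ‖z‖ = 1 := by
    rw [← Complex.norm_conj c, ← norm_mul, h1, norm_one]
  nlinarith [norm_nonneg c, norm_nonneg z]

theorem normSq_sub_sub_normSq_one_sub (c z : ℂ) :
    Complex.normSq (z - c) - Complex.normSq (1 - conj c * z) =
      (Complex.normSq z - 1) * (1 - Complex.normSq c) := by
  simp only [Complex.normSq_apply, Complex.sub_re, Complex.sub_im, Complex.one_re, Complex.one_im,
    Complex.mul_re, Complex.mul_im, Complex.conj_re, Complex.conj_im]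
  ring

theorem normSq_lt_one {c : ℂ} (hc : ‖c‖ < 1) : Complex.normSq c < 1 := by
  rw [Complex.normSq_eq_norm_sq]; nlinarith [norm_nonneg c]

theorem normSq_eq_one {c : ℂ} (hc : ‖c‖ = 1) : Complex.normSq c = 1 := by
  rw [Complex.normSq_eq_norm_sq, hc]; norm_num

theorem norm_eq_one_of_normSq {c : ℂ} (hc : Complex.normSq c = 1) : ‖c‖ = 1 := by
  rw [Complex.normSq_eq_norm_sq] at hc
  nlinarith [norm_nonneg c]

theorem norm_one_sub_le_norm_sub {c z : ℂ} (hc : ‖c‖ < 1) (hz : 1 ≤ ‖z‖) :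
    ‖1 - conj c * z‖ ≤ ‖z - c‖ := by
  have h := normSq_sub_sub_normSq_one_sub c z
  have h1 := normSq_lt_one hc
  have h2 : 1 ≤ Complex.normSq z := by rw [Complex.normSq_eq_norm_sq]; nlinarith
  refine le_of_sq_le_sq ?_ (norm_nonneg _)
  rw [← Complex.normSq_eq_norm_sq, ← Complex.normSq_eq_norm_sq]
  nlinarith

theorem norm_diskMobius {c z : ℂ} (hc : ‖c‖ < 1) (hz : ‖z‖ = 1) : ‖diskMobius c z‖ = 1 := by
  have h := normSq_sub_sub_normSq_one_sub c z
  rw [normSq_eq_one hz] at h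
  have h1 := one_sub_conj_mul_ne_zero hc hz.le
  apply norm_eq_one_of_normSq
  rw [diskMobius, Complex.normSq_div, div_eq_one_iff_eq (by simpa using h1)]
  linarith

theorem conj_mul_self_of_norm_eq_one {z : ℂ} (hz : ‖z‖ = 1) : conj z * z = 1 := by
  rw [mul_comm, Complex.mul_conj, normSq_eq_one hz]; norm_num

/-! ### Composing a Blaschke product with a disk automorphism on the left. -/

open Polynomial in
theorem exists_prod_roots {n : ℕ} (F : ℂ[X]) (h : F.natDegree = n) :
    ∃ b : Fin n → ℂ, F = C F.leadingCoeff * ∏ j, (X - C (b j)) := by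
  have hs := IsAlgClosed.splits F
  have hc : F.roots.toList.length = n := by
    rw [Multiset.length_toList, ← hs.natDegree_eq_card_roots, h]
  subst hc
  refine ⟨fun j => F.roots.toList.get j, ?_⟩
  conv_lhs => rw [hs.eq_prod_roots]
  congr 1
  conv_lhs => rw [← Multiset.coe_toList F.roots]
  rw [Multiset.map_coe, Multiset.prod_coe, ← List.prod_ofFn]
  congr 1
  exact (List.ofFn_getElem_eq_map _ _).symm

-- The two polynomial identities are the numerator and the denominator of `(B - w) / (1 - conj w *
-- B)`, showing that this is again a Blaschke product of degree `n`.
open Polynomial in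
theorem exists_blaschke_shift {n : ℕ} {γ : ℂ} (hγ : ‖γ‖ = 1) {a : Fin n → ℂ}
    (ha : ∀ j, ‖a j‖ < 1) {w : ℂ} (hw : ‖w‖ < 1) :
    ∃ (l : ℂ) (b : Fin n → ℂ), l ≠ 0 ∧ (∀ j, ‖b j‖ < 1) ∧
      (∀ z, γ * ∏ j, (z - a j) - w * ∏ j, (1 - conj (a j) * z) = l * ∏ j, (z - b j)) ∧
      (∀ z, ∏ j, (1 - conj (a j) * z) - conj w * (γ * ∏ j, (z - a j)) =
        γ * conj l * ∏ j, (1 - conj (b j) * z)) := by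
  set F : ℂ[X] := C γ * ∏ j, (X - C (a j)) - C w * ∏ j, (1 - C (conj (a j)) * X) with hF
  have hd1 : ∀ j, (X - C (a j)).natDegree ≤ 1 := fun j => by simp
  have hd2 : ∀ j, (1 - C (conj (a j)) * X).natDegree ≤ 1 := fun j => by
    compute_degree
  have hdeg : F.natDegree ≤ n := by
    refine (natDegree_sub_le _ _).trans (max_le ?_ ?_)
    · refine (natDegree_C_mul_le _ _).trans ((natDegree_prod_le _ _).trans ?_)
      exact (Finset.sum_le_sum fun j _ => hd1 j).trans (by simp)
    · refine (natDegree_C_mul_le _ _).trans ((natDegree_prod_le _ _).trans ?_)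
      exact (Finset.sum_le_sum fun j _ => hd2 j).trans (by simp)
  have hcoeff : F.coeff n = γ - w * ∏ j, (-conj (a j)) := by
    have e1 := coeff_prod_of_natDegree_le (s := Finset.univ) (fun j => X - C (a j)) 1
      (fun j _ => hd1 j)
    have e2 := coeff_prod_of_natDegree_le (s := Finset.univ) (fun j => 1 - C (conj (a j)) * X) 1
      (fun j _ => hd2 j)
    simp only [Finset.card_univ, Fintype.card_fin, mul_one] at e1 e2
    rw [hF, coeff_sub, coeff_C_mul, coeff_C_mul, e1, e2]
    simp [coeff_one, coeff_C]
  -- Vanishing would force `1 = ‖w‖ * ∏ ‖a j‖`, which is impossible since `‖w‖ < 1`.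
  have hne : F.coeff n ≠ 0 := by
    rw [hcoeff]
    intro h
    have h1 : ‖γ‖ = ‖w‖ * ∏ j, ‖a j‖ := by
      rw [sub_eq_zero.mp h, norm_mul, norm_prod]; simp
    have h2 : ∏ j, ‖a j‖ ≤ 1 := Finset.prod_le_one (fun _ _ => norm_nonneg _) fun j _ => (ha j).le
    nlinarith [norm_nonneg w, Finset.prod_nonneg (s := Finset.univ) fun j _ => norm_nonneg (a j)]
  have hnat : F.natDegree = n := le_antisymm hdeg (le_natDegree_of_ne_zero hne)
  obtain ⟨b, hb⟩ := exists_prod_roots F hnat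
  have hl : F.leadingCoeff ≠ 0 := by rwa [leadingCoeff, hnat]
  generalize F.leadingCoeff = l at hb hl
  have key : ∀ z, γ * ∏ j, (z - a j) - w * ∏ j, (1 - conj (a j) * z) = l * ∏ j, (z - b j) := by
    intro z
    have := congrArg (eval z) hb
    simpa [hF, eval_prod] using this
  -- Outside the open disk each `‖1 - conj a * z‖ ≤ ‖z - a‖`, so a root there would give `‖P‖ ≤ ‖w‖
  -- * ‖P‖` for the nonzero product `P = ∏ (z - a i)`.
  have hb1 : ∀ j, ‖b j‖ < 1 := by
    intro j
    by_contra! hj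
    have h0 : ∏ i, (b j - b i) = 0 := Finset.prod_eq_zero (Finset.mem_univ j) (sub_self _)
    have h1 := key (b j)
    rw [h0, mul_zero, sub_eq_zero] at h1
    have h2 : ‖∏ i, (1 - conj (a i) * b j)‖ ≤ ‖∏ i, (b j - a i)‖ := by
      rw [norm_prod, norm_prod]
      exact Finset.prod_le_prod (fun _ _ => norm_nonneg _)
        fun i _ => norm_one_sub_le_norm_sub (ha i) hj
    have h3 : 0 < ‖∏ i, (b j - a i)‖ := by
      rw [norm_pos_iff, Finset.prod_ne_zero_iff]
      intro i _ h
      rw [sub_eq_zero.mp h] at hj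
      exact absurd (ha i) (not_lt.mpr hj)
    have h4 := congrArg norm h1
    rw [norm_mul, norm_mul, hγ, one_mul] at h4
    nlinarith [norm_nonneg w]
  refine ⟨l, b, hl, hb1, key, ?_⟩
  have cont1 : Continuous fun z : ℂ =>
      ∏ j, (1 - conj (a j) * z) - conj w * (γ * ∏ j, (z - a j)) := by fun_prop
  have cont2 : Continuous fun z : ℂ => γ * conj l * ∏ j, (1 - conj (b j) * z) := by fun_prop
  -- The second identity is the first one reflected in the circle: conjugate `key` at `conj z⁻¹` and
  -- multiply by `z ^ n`. This needs `z ≠ 0`; continuity supplies the remaining point.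
  refine congrFun (cont1.ext_on (dense_compl_singleton (0 : ℂ)) cont2 ?_)
  intro z hz
  have hz : z ≠ 0 := hz
  have flip : ∀ d : Fin n → ℂ, z ^ n * ∏ j, (z⁻¹ - conj (d j)) = ∏ j, (1 - conj (d j) * z) := by
    intro d
    have : z ^ n = ∏ _j : Fin n, z := by simp
    rw [this, ← Finset.prod_mul_distrib]
    refine Finset.prod_congr rfl fun j _ => ?_
    field_simp
  have flip2 : z ^ n * ∏ j, (1 - a j * z⁻¹) = ∏ j, (z - a j) := by
    have : z ^ n = ∏ _j : Fin n, z := by simp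
    rw [this, ← Finset.prod_mul_distrib]
    refine Finset.prod_congr rfl fun j _ => ?_
    field_simp
  have h := congrArg conj (key (conj z⁻¹))
  simp only [map_sub, map_mul, map_prod, Complex.conj_conj, map_one] at h
  have hg := conj_mul_self_of_norm_eq_one hγ
  simp only
  rw [← flip a, ← flip b, ← flip2]
  linear_combination (γ * z ^ n) * h - (z ^ n * ∏ j, (z⁻¹ - conj (a j))) * hg

/-! ### Critical points of a Blaschke product away from its zeros. -/

theorem sub_mul_one_sub_of_norm_eq_one (t : ℂ) {z : ℂ} (hz : ‖z‖ = 1) :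
    (z - t) * (1 - conj t * z) = z * (Complex.normSq (z - t) : ℝ) := by
  rw [← Complex.mul_conj, map_sub]
  linear_combination (-(z - t)) * conj_mul_self_of_norm_eq_one hz

-- With suitable weights the sum is the logarithmic derivative of a Blaschke product with zero set
-- `S`. Its numerator `N` has no zero on the circle, where it is a power of `z` times a positive
-- number, and its zeros are symmetric under reflection in the circle. With none inside the disk
-- there would be none at all, so `N` would be constant, contradicting the reflection identity.
open Polynomial in
theorem exists_root_sum_div (S : Finset ℂ) (hS : ∀ s ∈ S, ‖s‖ < 1) (m : ℂ → ℝ)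
    (hm : ∀ s ∈ S, 0 < m s) (hcard : 2 ≤ S.card) :
    ∃ z, ‖z‖ < 1 ∧ z ∉ S ∧ ∑ s ∈ S, (m s : ℂ) / ((z - s) * (1 - conj s * z)) = 0 := by
  classical
  set N : ℂ[X] := ∑ s ∈ S, C (m s : ℂ) * ∏ t ∈ S.erase s, ((X - C t) * (1 - C (conj t) * X))
    with hN
  have heval : ∀ z, N.eval z =
      ∑ s ∈ S, (m s : ℂ) * ∏ t ∈ S.erase s, ((z - t) * (1 - conj t * z)) := by
    intro z
    simp [hN, eval_finsetSum, eval_prod]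
  have hnode : ∀ s ∈ S, N.eval s ≠ 0 := by
    intro s hs
    rw [heval, Finset.sum_eq_single_of_mem s hs]
    · refine mul_ne_zero (by exact_mod_cast (hm s hs).ne') (Finset.prod_ne_zero_iff.mpr ?_)
      intro t ht
      obtain ⟨hts, htS⟩ := Finset.mem_erase.mp ht
      exact mul_ne_zero (sub_ne_zero.mpr hts.symm)
        (one_sub_conj_mul_ne_zero (hS t htS) (hS s hs).le)
    · intro t _ hts
      rw [Finset.prod_eq_zero (Finset.mem_erase.mpr ⟨hts.symm, hs⟩) (by simp), mul_zero]
  have hcirc : ∀ z : ℂ, ‖z‖ = 1 → N.eval z ≠ 0 := by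
    intro z hz
    have hz0 : z ≠ 0 := by rintro rfl; simp at hz
    have : N.eval z = z ^ (S.card - 1) *
        ((∑ s ∈ S, m s * ∏ t ∈ S.erase s, Complex.normSq (z - t) : ℝ) : ℂ) := by
      rw [heval, Complex.ofReal_sum, Finset.mul_sum]
      refine Finset.sum_congr rfl fun s hs => ?_
      rw [Finset.prod_congr rfl fun t _ => sub_mul_one_sub_of_norm_eq_one t hz,
        Finset.prod_mul_distrib, Finset.prod_const, Finset.card_erase_of_mem hs]
      push_cast
      ring
    rw [this]
    refine mul_ne_zero (pow_ne_zero _ hz0) (Complex.ofReal_ne_zero.mpr (ne_of_gt ?_))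
    refine Finset.sum_pos (fun s hs => mul_pos (hm s hs) (Finset.prod_pos fun t ht => ?_))
      (Finset.card_pos.mp (by omega))
    rw [Complex.normSq_pos, sub_ne_zero]
    rintro rfl
    have := hS z (Finset.mem_of_mem_erase ht)
    linarith
  have hrefl : ∀ z : ℂ, z ≠ 0 →
      (z ^ 2) ^ (S.card - 1) * conj (N.eval (conj z⁻¹)) = N.eval z := by
    intro z hz
    rw [heval, heval, map_sum, Finset.mul_sum]
    refine Finset.sum_congr rfl fun s hs => ?_
    rw [map_mul, map_prod, Complex.conj_ofReal, mul_left_comm,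
      ← Finset.card_erase_of_mem hs, ← Finset.prod_const, ← Finset.prod_mul_distrib]
    congr 1
    refine Finset.prod_congr rfl fun t _ => ?_
    simp only [map_mul, map_sub, map_one, Complex.conj_conj]
    field_simp
  have hroot : ∃ z, ‖z‖ < 1 ∧ N.eval z = 0 := by
    by_contra! hno
    have hnone : ∀ z, N.eval z ≠ 0 := by
      intro z hz
      rcases lt_trichotomy ‖z‖ 1 with h | h | h
      · exact hno z h hz
      · exact hcirc z h hz
      · have hz0 : z ≠ 0 := by rintro rfl; simp at h; linarith
        rw [← hrefl z hz0, mul_eq_zero, map_eq_zero] at hz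
        rcases hz with hz | hz
        · exact pow_ne_zero _ (pow_ne_zero _ hz0) hz
        · refine hno _ ?_ hz
          rw [Complex.norm_conj, norm_inv]
          exact inv_lt_one_of_one_lt₀ h
    have hdeg : N.degree = 0 := by
      by_contra hd
      obtain ⟨x, hx⟩ := IsAlgClosed.exists_root N hd
      exact hnone x hx
    rw [eq_C_of_degree_eq_zero hdeg] at hnone hrefl
    -- For constant `N` the reflection identity at `2` reads `4 ^ (card - 1) * ‖N‖ = ‖N‖`; this is
    -- where two distinct nodes are needed.
    have h2 := congrArg norm (hrefl 2 two_ne_zero)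
    simp only [eval_C, norm_mul, norm_pow, Complex.norm_conj, Complex.norm_ofNat] at h2 hnone
    have hpos : 0 < ‖N.coeff 0‖ := norm_pos_iff.mpr (hnone 0)
    have h3 : (1 : ℝ) < (2 ^ 2) ^ (S.card - 1) := one_lt_pow₀ (by norm_num) (by omega)
    nlinarith
  obtain ⟨z, hz, hNz⟩ := hroot
  have hzS : z ∉ S := fun h => hnode z h hNz
  refine ⟨z, hz, hzS, ?_⟩
  have hfac : ∀ t ∈ S, (z - t) * (1 - conj t * z) ≠ 0 := fun t ht =>
    mul_ne_zero (sub_ne_zero.mpr fun h => hzS (h ▸ ht)) (one_sub_conj_mul_ne_zero (hS t ht) hz.le)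
  have hprod := Finset.prod_ne_zero_iff.mpr hfac
  refine (mul_eq_zero.mp ?_).resolve_left hprod
  rw [Finset.mul_sum, ← hNz, heval]
  refine Finset.sum_congr rfl fun s hs => ?_
  rw [← Finset.mul_prod_erase S _ hs]
  rw [mul_comm, div_mul_eq_mul_div, div_eq_iff (hfac s hs)]
  ring

theorem hasDerivAt_diskMobius {c z : ℂ} (h : 1 - conj c * z ≠ 0) :
    HasDerivAt (diskMobius c) ((1 - Complex.normSq c : ℝ) / (1 - conj c * z) ^ 2) z := by
  have h1 : HasDerivAt (fun z : ℂ => z - c) 1 z := (hasDerivAt_id z).sub_const c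
  have h2 : HasDerivAt (fun z : ℂ => 1 - conj c * z) (-(conj c)) z := by
    simpa using ((hasDerivAt_id z).const_mul (conj c)).const_sub 1
  refine (h1.div h2 h).congr_deriv ?_
  rw [Complex.ofReal_sub, ← Complex.mul_conj]
  push_cast
  ring

theorem hasDerivAt_prod_diskMobius_zero {n : ℕ} {b : Fin n → ℂ} (hb : ∀ j, ‖b j‖ < 1) {z : ℂ}
    (hz : ‖z‖ < 1) (hzb : ∀ j, z ≠ b j)
    (h : ∑ j, ((1 - Complex.normSq (b j) : ℝ) : ℂ) / ((z - b j) * (1 - conj (b j) * z)) = 0) :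
    HasDerivAt (fun z => ∏ j, diskMobius (b j) z) 0 z := by
  have hd : ∀ j, 1 - conj (b j) * z ≠ 0 := fun j => one_sub_conj_mul_ne_zero (hb j) hz.le
  have hdiff : ∀ j ∈ Finset.univ, DifferentiableAt ℂ (diskMobius (b j)) z := fun j _ =>
    (hasDerivAt_diskMobius (hd j)).differentiableAt
  have hne : ∀ j ∈ Finset.univ, diskMobius (b j) z ≠ 0 := fun j _ =>
    div_ne_zero (sub_ne_zero.mpr (hzb j)) (hd j)
  have hlog := logDeriv_prod hne hdiff
  have hsum : ∑ j, logDeriv (diskMobius (b j)) z = 0 := by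
    rw [← h]
    refine Finset.sum_congr rfl fun j _ => ?_
    rw [logDeriv_apply, (hasDerivAt_diskMobius (hd j)).deriv, diskMobius]
    have := hd j
    have := sub_ne_zero.mpr (hzb j)
    field_simp
  rw [hsum, logDeriv_apply, div_eq_zero_iff] at hlog
  have hder := hlog.resolve_right (Finset.prod_ne_zero_iff.mpr hne)
  have hD : DifferentiableAt ℂ (fun z => ∏ j, diskMobius (b j) z) z :=
    DifferentiableAt.fun_finsetProd hdiff
  rw [← hder]
  exact hD.hasDerivAt

/-! ### One critical value forces a power. -/

theorem blaschke_shift_eq {n : ℕ} {γ : ℂ} (hγ : ‖γ‖ = 1) {a b : Fin n → ℂ} {w l : ℂ}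
    (ha : ∀ j, ‖a j‖ < 1) (hl : l ≠ 0) (hb : ∀ j, ‖b j‖ < 1)
    (h1 : ∀ z, γ * ∏ j, (z - a j) - w * ∏ j, (1 - conj (a j) * z) = l * ∏ j, (z - b j))
    (h2 : ∀ z, ∏ j, (1 - conj (a j) * z) - conj w * (γ * ∏ j, (z - a j)) =
        γ * conj l * ∏ j, (1 - conj (b j) * z)) {z : ℂ} (hz : ‖z‖ ≤ 1) :
    1 - conj w * blaschkeProduct γ a z ≠ 0 ∧
    blaschkeProduct γ a z - w = l / (γ * conj l) * (∏ j, diskMobius (b j) z) *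
      (1 - conj w * blaschkeProduct γ a z) := by
  have hγ0 : γ ≠ 0 := by rintro rfl; simp at hγ
  have hl' : conj l ≠ 0 := by simpa using hl
  have ha' := Finset.prod_ne_zero_iff.mpr fun j (_ : j ∈ Finset.univ) =>
    one_sub_conj_mul_ne_zero (ha j) hz
  have hb' := Finset.prod_ne_zero_iff.mpr fun j (_ : j ∈ Finset.univ) =>
    one_sub_conj_mul_ne_zero (hb j) hz
  have hB : blaschkeProduct γ a z = γ * ((∏ j, (z - a j)) / ∏ j, (1 - conj (a j) * z)) := by
    rw [blaschkeProduct, Finset.prod_div_distrib]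
  have hφ : ∏ j, diskMobius (b j) z = (∏ j, (z - b j)) / ∏ j, (1 - conj (b j) * z) := by
    simp only [diskMobius]
    rw [Finset.prod_div_distrib]
  specialize h1 z
  specialize h2 z
  rw [hB, hφ]
  generalize ∏ j, (z - a j) = P at *
  generalize ∏ j, (1 - conj (a j) * z) = Q at *
  generalize ∏ j, (z - b j) = F at *
  generalize ∏ j, (1 - conj (b j) * z) = G at *
  have e1 : 1 - conj w * (γ * (P / Q)) = γ * conj l * G / Q := by
    rw [← h2]; field_simp
  have e2 : γ * (P / Q) - w = l * F / Q := by
    rw [← h1]; field_simp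
  rw [e1, e2]
  refine ⟨by positivity, ?_⟩
  field_simp

theorem norm_diskMobius_lt_one {c z : ℂ} (hc : ‖c‖ < 1) (hz : ‖z‖ < 1) : ‖diskMobius c z‖ < 1 := by
  have h := normSq_sub_sub_normSq_one_sub c z
  have h1 := norm_pos_iff.mpr (one_sub_conj_mul_ne_zero hc hz.le)
  have h2 : Complex.normSq (z - c) < Complex.normSq (1 - conj c * z) := by
    nlinarith [normSq_lt_one hc, normSq_lt_one hz]
  rw [Complex.normSq_eq_norm_sq, Complex.normSq_eq_norm_sq] at h2
  rw [diskMobius, norm_div, div_lt_one h1]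
  exact lt_of_pow_lt_pow_left₀ 2 h1.le h2

theorem norm_blaschkeProduct_lt_one {n : ℕ} (hn : n ≠ 0) {γ : ℂ} (hγ : ‖γ‖ = 1) {a : Fin n → ℂ}
    (ha : ∀ j, ‖a j‖ < 1) {z : ℂ} (hz : ‖z‖ < 1) : ‖blaschkeProduct γ a z‖ < 1 := by
  obtain ⟨k, rfl⟩ := Nat.exists_eq_succ_of_ne_zero hn
  have h : ‖blaschkeProduct γ a z‖ =
      ‖diskMobius (a 0) z‖ * ∏ j : Fin k, ‖diskMobius (a j.succ) z‖ := by
    rw [← Fin.prod_univ_succ fun j => ‖diskMobius (a j) z‖, blaschkeProduct, norm_mul, hγ, one_mul,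
      norm_prod]
    rfl
  rw [h]
  exact mul_lt_one_of_nonneg_of_lt_one_left (norm_nonneg _) (norm_diskMobius_lt_one (ha 0) hz)
    (Finset.prod_le_one (fun _ _ => norm_nonneg _)
      fun j _ => (norm_diskMobius_lt_one (ha j.succ) hz).le)

theorem norm_blaschkeProduct_eq_one {n : ℕ} {γ : ℂ} (hγ : ‖γ‖ = 1) {a : Fin n → ℂ}
    (ha : ∀ j, ‖a j‖ < 1) {z : ℂ} (hz : ‖z‖ = 1) : ‖blaschkeProduct γ a z‖ = 1 := by
  rw [blaschkeProduct, norm_mul, hγ, one_mul, norm_prod]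
  exact Finset.prod_eq_one fun j _ => norm_diskMobius (ha j) hz

/-- A Blaschke product with a single critical value is, up to disk automorphisms on both sides,
a power. -/
theorem exists_shift_eq_pow {n : ℕ} {γ : ℂ} (hγ : ‖γ‖ = 1) {a : Fin n → ℂ} (ha : ∀ j, ‖a j‖ < 1)
    (hcrit : ∃! w : ℂ, w ∈ criticalValues (blaschkeProduct γ a)) :
    2 ≤ n ∧ ∃ w η c : ℂ, ‖w‖ < 1 ∧ ‖η‖ = 1 ∧ ‖c‖ < 1 ∧ ∀ z, ‖z‖ ≤ 1 →
      1 - conj w * blaschkeProduct γ a z ≠ 0 ∧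
      blaschkeProduct γ a z - w =
        η * diskMobius c z ^ n * (1 - conj w * blaschkeProduct γ a z) := by
  classical
  obtain ⟨w, ⟨hw, z₀, hz₀, hder, hBz₀⟩, huniq⟩ := hcrit
  rw [mem_ball_zero_iff] at hw hz₀
  have hγ0 : γ ≠ 0 := by rintro rfl; simp at hγ
  have hn : 2 ≤ n := by
    -- For `n = 0` the only value is `γ`, outside the open disk; for `n = 1` the derivative never
    -- vanishes.
    rcases n with _ | _ | n
    · simp only [blaschkeProduct, Finset.univ_eq_empty, Finset.prod_empty, mul_one] at hBz₀
      rw [hBz₀] at hγ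
      linarith
    · exfalso
      have hd := one_sub_conj_mul_ne_zero (ha 0) hz₀.le
      have hB : blaschkeProduct γ a = fun z => γ * diskMobius (a 0) z := by
        funext z
        simp [blaschkeProduct, diskMobius]
      rw [hB, ((hasDerivAt_diskMobius hd).const_mul γ).deriv] at hder
      have h1 : ((1 - Complex.normSq (a 0) : ℝ) : ℂ) ≠ 0 := by
        have := normSq_lt_one (ha 0)
        exact_mod_cast (sub_pos.mpr this).ne'
      exact mul_ne_zero hγ0 (div_ne_zero h1 (pow_ne_zero 2 hd)) hder
    · omega
  refine ⟨hn, w, ?_⟩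
  obtain ⟨l, b, hl, hb, h1, h2⟩ := exists_blaschke_shift hγ ha hw
  have hshift := fun z (hz : ‖z‖ ≤ 1) => blaschke_shift_eq hγ ha hl hb h1 h2 hz
  have hη : ‖l / (γ * conj l)‖ = 1 := by
    rw [norm_div, norm_mul, hγ, Complex.norm_conj, one_mul, div_self (norm_ne_zero_iff.mpr hl)]
  generalize l / (γ * conj l) = η at hshift hη
  have hη0 : η ≠ 0 := by rintro rfl; simp at hη
  have hconst : (Finset.univ.image b).card < 2 := by
    by_contra! hcard
    -- The nodes are the distinct zeros, so each weight carries the multiplicity of its zero.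
    obtain ⟨z, hz, hzS, hsum⟩ := exists_root_sum_div (Finset.univ.image b)
      (by simpa using hb)
      (fun s => (Finset.univ.filter fun j => b j = s).card * (1 - Complex.normSq s))
      (by
        intro s hs
        obtain ⟨j, -, rfl⟩ := Finset.mem_image.mp hs
        refine mul_pos (Nat.cast_pos.mpr (Finset.card_pos.mpr ⟨j, by simp⟩)) ?_
        exact sub_pos.mpr (normSq_lt_one (hb j))) hcard
    have hzb : ∀ j, z ≠ b j := by
      rintro j rfl
      exact hzS (Finset.mem_image_of_mem b (Finset.mem_univ j))
    have hsum' : ∑ j, ((1 - Complex.normSq (b j) : ℝ) : ℂ) /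
        ((z - b j) * (1 - conj (b j) * z)) = 0 := by
      rw [Finset.sum_comp (fun s => ((1 - Complex.normSq s : ℝ) : ℂ) /
        ((z - s) * (1 - conj s * z))) b, ← hsum]
      refine Finset.sum_congr rfl fun s _ => ?_
      rw [nsmul_eq_mul]
      push_cast
      ring
    have hD := (hasDerivAt_prod_diskMobius_zero hb hz hzb hsum').const_mul η
    set g : ℂ → ℂ := fun z => η * ∏ j, diskMobius (b j) z with hg
    -- Solving the shift relation for `B` as a Möbius function of `g` turns the critical point of
    -- `g` into one of `B`.
    have hinv : ∀ x, ‖x‖ ≤ 1 → 1 + conj w * g x ≠ 0 ∧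
        blaschkeProduct γ a x = (g x + w) / (1 + conj w * g x) := by
      intro x hx
      obtain ⟨hne, he⟩ := hshift x hx
      have e : (1 + conj w * g x) * (1 - conj w * blaschkeProduct γ a x) =
          ((1 - Complex.normSq w : ℝ) : ℂ) := by
        rw [Complex.ofReal_sub, ← Complex.mul_conj]
        push_cast
        linear_combination (-conj w) * he
      have h3 : 1 + conj w * g x ≠ 0 := by
        intro h0
        rw [h0, zero_mul] at e
        have := normSq_lt_one hw
        exact (sub_pos.mpr this).ne' (by exact_mod_cast e.symm)
      refine ⟨h3, ?_⟩
      rw [eq_div_iff h3]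
      linear_combination he
    have hD2 : HasDerivAt (blaschkeProduct γ a) 0 z := by
      have h4 := (hD.add_const w).div ((hD.const_mul (conj w)).const_add 1) (hinv z hz.le).1
      simp only [mul_zero, zero_mul, sub_zero, zero_div] at h4
      refine h4.congr_of_eventuallyEq ?_
      filter_upwards [Metric.isOpen_ball.mem_nhds (mem_ball_zero_iff.mpr hz)] with x hx
      exact (hinv x (mem_ball_zero_iff.mp hx).le).2
    have hgz : g z ≠ 0 := mul_ne_zero hη0 <| Finset.prod_ne_zero_iff.mpr fun j _ =>
      div_ne_zero (sub_ne_zero.mpr (hzb j)) (one_sub_conj_mul_ne_zero (hb j) hz.le)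
    -- Uniqueness makes the value at this critical point `w`, hence `g z = 0`, although `z` is none
    -- of the zeros of `g`.
    have hBz : blaschkeProduct γ a z = w := huniq _ ⟨mem_ball_zero_iff.mpr
      (norm_blaschkeProduct_lt_one (by omega) hγ ha hz), z, mem_ball_zero_iff.mpr hz, hD2.deriv, rfl⟩
    obtain ⟨hne, he⟩ := hshift z hz.le
    rw [hBz] at hne he
    rw [sub_self] at he
    exact mul_ne_zero hgz hne he.symm
  have hc : ∀ j, b j = b ⟨0, by omega⟩ := fun j =>
    Finset.card_le_one.mp (Nat.lt_succ_iff.mp hconst) _ (by simp) _ (by simp)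
  refine ⟨η, b ⟨0, by omega⟩, hw, hη, hb _, fun z hz => ?_⟩
  have := hshift z hz
  rwa [Finset.prod_congr rfl fun j _ => by rw [hc j], Finset.prod_const, Finset.card_univ,
    Fintype.card_fin] at this

/-- On the unit circle, the fibers of a Blaschke product with a single critical value are carried by
a disk automorphism to the sets of `n`-th roots of unimodular numbers. -/
theorem exists_fiber_iff_pow {n : ℕ} {γ : ℂ} (hγ : ‖γ‖ = 1) {a : Fin n → ℂ} (ha : ∀ j, ‖a j‖ < 1)
    (hcrit : ∃! w : ℂ, w ∈ criticalValues (blaschkeProduct γ a)) :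
    2 ≤ n ∧ ∃ c : ℂ, ‖c‖ < 1 ∧ ∀ l, ‖l‖ = 1 → ∃ μ : ℂ, ‖μ‖ = 1 ∧ ∀ z, ‖z‖ = 1 →
      (blaschkeProduct γ a z = l ↔ diskMobius c z ^ n = μ) := by
  obtain ⟨hn, w, η, c, hw, hη, hc, h⟩ := exists_shift_eq_pow hγ ha hcrit
  refine ⟨hn, c, hc, fun l hl => ⟨diskMobius w l / η, ?_, fun z hz => ?_⟩⟩
  · rw [norm_div, norm_diskMobius hw hl, hη, div_one]
  · have hη0 : η ≠ 0 := by rintro rfl; simp at hη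
    obtain ⟨h1, h2⟩ := h z hz.le
    have h3 := one_sub_conj_mul_ne_zero hw hl.le
    rw [eq_div_iff hη0, mul_comm, ← div_eq_iff h1 |>.mpr h2, diskMobius]
    constructor
    · rintro rfl; rfl
    · intro h4
      rw [div_eq_div_iff h1 h3] at h4
      have h5 : ((1 - Complex.normSq w : ℝ) : ℂ) * (blaschkeProduct γ a z - l) = 0 := by
        rw [Complex.ofReal_sub, ← Complex.mul_conj]
        push_cast
        linear_combination h4
      refine sub_eq_zero.mp ((mul_eq_zero.mp h5).resolve_left ?_)
      exact_mod_cast (sub_pos.mpr (normSq_lt_one hw)).ne'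

/-! ### The projective extension of a disk automorphism and the conic. -/

/-- The denominator of the projective map of the plane that extends `diskMobius c` from the unit
circle. -/
noncomputable def projDenom (c z : ℂ) : ℝ := 1 + Complex.normSq c - 2 * (conj c * z).re

/-- The numerator of the projective map of the plane that extends `diskMobius c` from the unit
circle. -/
noncomputable def projNum (c z : ℂ) : ℂ := z - 2 * c + c ^ 2 * conj z

/-- The quadratic form whose zero set is the image of the circle of radius `√(1 - δ)` under the
projective extension of `diskMobius (-c)`. -/
noncomputable def conicForm (δ : ℝ) (c z : ℂ) : ℝ :=
  δ * projDenom c z ^ 2 - (1 - Complex.normSq c) ^ 2 * (1 - Complex.normSq z)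

/-- The gradient of `conicForm δ c`. -/
noncomputable def conicGrad (δ : ℝ) (c z : ℂ) : ℂ :=
  (2 * (1 - Complex.normSq c) ^ 2 : ℝ) * z - (4 * δ * projDenom c z : ℝ) * c

/-- The bilinear part of `conicForm δ c`. -/
noncomputable def conicPolar (δ : ℝ) (c v w : ℂ) : ℝ :=
  4 * δ * (conj c * v).re * (conj c * w).re + (1 - Complex.normSq c) ^ 2 * (conj v * w).re

theorem conicForm_add (δ : ℝ) (c p v : ℂ) :
    conicForm δ c (p + v) =
      conicForm δ c p + (conj (conicGrad δ c p) * v).re + conicPolar δ c v v := by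
  simp only [conicForm, conicGrad, conicPolar, projDenom, Complex.normSq_apply, Complex.sub_re,
    Complex.sub_im, Complex.add_re, Complex.add_im, Complex.mul_re, Complex.mul_im, Complex.conj_re,
    Complex.conj_im, Complex.ofReal_re, Complex.ofReal_im, map_sub, map_mul, Complex.conj_ofReal]
  ring

theorem conicPolar_self (δ : ℝ) (c v : ℂ) :
    conicPolar δ c v v = 4 * δ * (conj c * v).re ^ 2 +
      (1 - Complex.normSq c) ^ 2 * Complex.normSq v := by
  simp only [conicPolar, Complex.normSq_apply, Complex.mul_re, Complex.conj_re, Complex.conj_im]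
  ring

theorem conicPolar_self_nonneg {δ : ℝ} (hδ : 0 ≤ δ) (c v : ℂ) : 0 ≤ conicPolar δ c v v := by
  rw [conicPolar_self]
  have := Complex.normSq_nonneg v
  positivity

theorem conicPolar_self_pos {δ : ℝ} (hδ : 0 ≤ δ) {c v : ℂ} (hc : ‖c‖ < 1) (hv : v ≠ 0) :
    0 < conicPolar δ c v v := by
  rw [conicPolar_self]
  have h1 := Complex.normSq_pos.mpr hv
  have h2 := sub_pos.mpr (normSq_lt_one hc)
  positivity

theorem continuous_conicForm (δ : ℝ) (c : ℂ) : Continuous (conicForm δ c) := by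
  unfold conicForm projDenom
  have := Complex.continuous_normSq
  fun_prop

theorem projDenom_pos {c z : ℂ} (hc : ‖c‖ < 1) (hz : ‖z‖ ≤ 1) : 0 < projDenom c z := by
  have h := Complex.re_le_norm (conj c * z)
  rw [norm_mul, Complex.norm_conj] at h
  rw [projDenom, Complex.normSq_eq_norm_sq]
  nlinarith [norm_nonneg c, norm_nonneg z, mul_le_mul_of_nonneg_left hz (norm_nonneg c),
    sq_pos_of_pos (sub_pos.mpr hc)]

/-- The projective map preserves the unit circle. It also follows that `conicForm δ c` is `normSq
(projNum c z) - (1 - δ) * projDenom c z ^ 2`, which makes its zero set the preimage of a circle. -/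
theorem projDenom_sq_sub_normSq_projNum (c z : ℂ) :
    projDenom c z ^ 2 - Complex.normSq (projNum c z) =
      (1 - Complex.normSq c) ^ 2 * (1 - Complex.normSq z) := by
  simp only [projDenom, projNum, pow_two, Complex.normSq_apply, Complex.sub_re, Complex.sub_im,
    Complex.add_re, Complex.add_im, Complex.mul_re, Complex.mul_im, Complex.conj_re,
    Complex.conj_im, Complex.re_ofNat, Complex.im_ofNat]
  ring

theorem projNum_neg_div (c z : ℂ) {L : ℝ} (hL : L ≠ 0) (h : projDenom c z = L) :
    projNum (-c) (projNum c z / L) = ((1 - Complex.normSq c) ^ 2 / L : ℝ) * z := by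
  have hL' : (L : ℂ) ≠ 0 := by exact_mod_cast hL
  have e : (L : ℂ) = 1 + c * conj c - (conj c * z + c * conj z) := by
    rw [← h, projDenom, Complex.mul_conj]
    have := Complex.add_conj (conj c * z)
    simp only [map_mul, Complex.conj_conj] at this
    rw [this]
    push_cast
    ring
  have e2 : ((Complex.normSq c : ℝ) : ℂ) = c * conj c := (Complex.mul_conj c).symm
  simp only [projNum, map_add, map_sub, map_mul, map_div₀, map_pow, Complex.conj_conj,
    Complex.conj_ofReal, map_ofNat]
  push_cast
  rw [e2]
  field_simp
  rw [e]
  ring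

theorem projDenom_neg_div (c z : ℂ) {L : ℝ} (hL : L ≠ 0) (h : projDenom c z = L) :
    projDenom (-c) (projNum c z / L) = (1 - Complex.normSq c) ^ 2 / L := by
  rw [eq_div_iff hL]
  have h1 : (conj (-c) * (projNum c z / L)).re * L = -(conj c * projNum c z).re := by
    have : conj (-c) * (projNum c z / L) = -(conj c * projNum c z) / L := by
      rw [map_neg]; ring
    rw [this, Complex.div_ofReal_re, Complex.neg_re]
    field_simp
  rw [projDenom, sub_mul, mul_assoc, h1, ← h]
  simp only [projDenom, projNum, pow_two, Complex.normSq_apply, Complex.sub_re, Complex.sub_im,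
    Complex.add_re, Complex.add_im, Complex.mul_re, Complex.mul_im, Complex.conj_re,
    Complex.conj_im, Complex.re_ofNat, Complex.im_ofNat, Complex.neg_re, Complex.neg_im]
  ring

theorem projMap_neg_projMap {c z : ℂ} (hc : ‖c‖ < 1) (hz : ‖z‖ ≤ 1) :
    projNum (-c) (projNum c z / projDenom c z) / projDenom (-c) (projNum c z / projDenom c z) =
      z := by
  have hL := (projDenom_pos hc hz).ne'
  rw [projNum_neg_div c z hL rfl, projDenom_neg_div c z hL rfl]
  have h2 := (sub_pos.mpr (normSq_lt_one hc)).ne'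
  rw [mul_div_cancel_left₀]
  exact_mod_cast (by positivity)

theorem normSq_one_sub_eq_projDenom (c : ℂ) {z : ℂ} (hz : ‖z‖ = 1) :
    Complex.normSq (1 - conj c * z) = projDenom c z := by
  rw [Complex.normSq_sub, Complex.normSq_mul, Complex.normSq_conj, normSq_eq_one hz, projDenom]
  simp

theorem projNum_div_projDenom {c z : ℂ} (hc : ‖c‖ < 1) (hz : ‖z‖ = 1) :
    projNum c z / projDenom c z = diskMobius c z := by
  rw [← normSq_one_sub_eq_projDenom c hz, diskMobius, ← Complex.mul_conj]
  have h1 := one_sub_conj_mul_ne_zero hc hz.le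
  have h2 : conj (1 - conj c * z) ≠ 0 := (map_ne_zero _).mpr h1
  rw [div_eq_div_iff (mul_ne_zero h1 h2) h1, projNum]
  simp only [map_sub, map_mul, map_one, Complex.conj_conj]
  linear_combination (c * (1 - conj c * z)) * conj_mul_self_of_norm_eq_one hz

theorem diskMobius_neg_diskMobius {c z : ℂ} (hc : ‖c‖ < 1) (hz : ‖z‖ ≤ 1) :
    diskMobius (-c) (diskMobius c z) = z := by
  have h1 := one_sub_conj_mul_ne_zero hc hz
  have h2 : (1 : ℂ) - c * conj c ≠ 0 := by
    rw [Complex.mul_conj]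
    exact_mod_cast (sub_pos.mpr (normSq_lt_one hc)).ne'
  have e1 : diskMobius c z - -c = z * (1 - c * conj c) / (1 - conj c * z) := by
    rw [diskMobius, eq_div_iff h1, sub_mul, div_mul_cancel₀ _ h1]; ring
  have e2 : 1 - conj (-c) * diskMobius c z = (1 - c * conj c) / (1 - conj c * z) := by
    rw [diskMobius, map_neg, eq_div_iff h1, sub_mul, mul_assoc, div_mul_cancel₀ _ h1]; ring
  rw [diskMobius, e1, e2, div_div_div_cancel_right₀ h1, mul_div_cancel_right₀ _ h2]

theorem diskMobius_diskMobius_neg {c z : ℂ} (hc : ‖c‖ < 1) (hz : ‖z‖ ≤ 1) :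
    diskMobius c (diskMobius (-c) z) = z := by
  simpa using diskMobius_neg_diskMobius (c := -c) (by simpa using hc) hz

theorem diskMobius_sub_diskMobius {c z w : ℂ} (hz : 1 - conj c * z ≠ 0) (hw : 1 - conj c * w ≠ 0) :
    diskMobius c z - diskMobius c w =
      (1 - Complex.normSq c : ℝ) * (z - w) / ((1 - conj c * z) * (1 - conj c * w)) := by
  rw [Complex.ofReal_sub, ← Complex.mul_conj, diskMobius, diskMobius]
  rw [div_sub_div _ _ hz hw]
  congr 1
  push_cast
  ring

theorem normSq_diskMobius_sub {c z w : ℂ} (hc : ‖c‖ < 1) (hz : ‖z‖ = 1) (hw : ‖w‖ = 1) :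
    (1 - Complex.normSq c) ^ 2 * Complex.normSq (z - w) =
      Complex.normSq (diskMobius c z - diskMobius c w) * (projDenom c z * projDenom c w) := by
  have h1 := (projDenom_pos hc hz.le).ne'
  have h2 := (projDenom_pos hc hw.le).ne'
  rw [diskMobius_sub_diskMobius (one_sub_conj_mul_ne_zero hc hz.le)
    (one_sub_conj_mul_ne_zero hc hw.le), Complex.normSq_div, Complex.normSq_mul, Complex.normSq_mul,
    normSq_one_sub_eq_projDenom c hz, normSq_one_sub_eq_projDenom c hw, Complex.normSq_ofReal]
  field_simp

/-- On the unit circle `conj z = 1 / z`, so the orientation of a triangle becomes a product of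
differences, and a Möbius map acts on differences factor by factor. -/
theorem im_conj_mul_eq {z w v : ℂ} (hz : ‖z‖ = 1) (hw : ‖w‖ = 1) (hv : ‖v‖ = 1) :
    (2 * (conj (w - z) * (v - z)).im : ℂ) * Complex.I * (z * w * v) =
      (w - z) * (v - z) * (w - v) := by
  have h := Complex.sub_conj (conj (w - z) * (v - z))
  push_cast at h
  rw [← h]
  simp only [map_mul, map_sub, Complex.conj_conj]
  have e1 := conj_mul_self_of_norm_eq_one hz
  have e2 := conj_mul_self_of_norm_eq_one hw
  have e3 := conj_mul_self_of_norm_eq_one hv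
  linear_combination (z * v * (v - z)) * e2 - (z * w * (w - z)) * e3 +
    (w * v * (w - v)) * e1

/-- The two orientations differ by a positive factor, so `diskMobius c` matches polygon sides with
polygon sides. -/
theorem im_conj_mul_diskMobius {c z w v : ℂ} (hc : ‖c‖ < 1) (hz : ‖z‖ = 1) (hw : ‖w‖ = 1)
    (hv : ‖v‖ = 1) :
    (conj (diskMobius c w - diskMobius c z) * (diskMobius c v - diskMobius c z)).im *
        (projDenom c z * projDenom c w * projDenom c v) =
      (conj (w - z) * (v - z)).im * (1 - Complex.normSq c) ^ 3 := by
  have dz := one_sub_conj_mul_ne_zero hc hz.le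
  have dw := one_sub_conj_mul_ne_zero hc hw.le
  have dv := one_sub_conj_mul_ne_zero hc hv.le
  have ne : ∀ {z : ℂ}, ‖z‖ = 1 → z ≠ 0 := by
    rintro z hz rfl
    simp at hz
  have key := im_conj_mul_eq (norm_diskMobius hc hz) (norm_diskMobius hc hw)
    (norm_diskMobius hc hv)
  have key' := im_conj_mul_eq hz hw hv
  have hφ : ∀ {z : ℂ}, ‖z‖ = 1 →
      diskMobius c z * (1 - conj c * z) ^ 2 = z * (projDenom c z : ℂ) := by
    intro z hz
    have h := one_sub_conj_mul_ne_zero hc hz.le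
    rw [← normSq_one_sub_eq_projDenom c hz, ← Complex.mul_conj, diskMobius]
    simp only [map_sub, map_mul, map_one, Complex.conj_conj]
    field_simp
    linear_combination (c * (1 - conj c * z)) * conj_mul_self_of_norm_eq_one hz
  have hzφ := hφ hz
  have hwφ := hφ hw
  have hvφ := hφ hv
  have s1 := diskMobius_sub_diskMobius dw dz
  have s2 := diskMobius_sub_diskMobius dv dz
  have s3 := diskMobius_sub_diskMobius dw dv
  rw [eq_div_iff (mul_ne_zero dw dz)] at s1
  rw [eq_div_iff (mul_ne_zero dv dz)] at s2
  rw [eq_div_iff (mul_ne_zero dw dv)] at s3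
  have hne : 2 * Complex.I * (z * w * v) ≠ 0 := by
    exact mul_ne_zero (mul_ne_zero two_ne_zero Complex.I_ne_zero)
      (mul_ne_zero (mul_ne_zero (ne hz) (ne hw)) (ne hv))
  generalize (conj (diskMobius c w - diskMobius c z) * (diskMobius c v - diskMobius c z)).im = A
    at key ⊢
  generalize (conj (w - z) * (v - z)).im = A' at key' ⊢
  have : (A * (projDenom c z * projDenom c w * projDenom c v) : ℂ) =
      A' * ((1 - Complex.normSq c : ℝ) : ℂ) ^ 3 := by
    refine mul_right_cancel₀ hne ?_
    generalize ((1 - Complex.normSq c : ℝ) : ℂ) = k at *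
    generalize (projDenom c z : ℂ) = Lz at *
    generalize (projDenom c w : ℂ) = Lw at *
    generalize (projDenom c v : ℂ) = Lv at *
    generalize diskMobius c z = fz at *
    generalize diskMobius c w = fw at *
    generalize diskMobius c v = fv at *
    generalize 1 - conj c * z = Dz at *
    generalize 1 - conj c * w = Dw at *
    generalize 1 - conj c * v = Dv at *
    calc _ = 2 * A * Complex.I * ((z * Lz) * (w * Lw) * (v * Lv)) := by ring
      _ = (2 * A * Complex.I * (fz * fw * fv)) * (Dz * Dw * Dv) ^ 2 := by
        rw [← hzφ, ← hwφ, ← hvφ]; ring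
      _ = ((fw - fz) * (Dw * Dz)) * ((fv - fz) * (Dv * Dz)) * ((fw - fv) * (Dw * Dv)) := by
        rw [key]; ring
      _ = k ^ 3 * ((w - z) * (v - z) * (w - v)) := by rw [s1, s2, s3]; ring
      _ = _ := by rw [← key']; ring
  exact_mod_cast this

/-- Numerator and denominator are real-affine, so a convex combination goes to one with weights
rescaled by `projDenom`; positivity of the denominator keeps the weights nonnegative. -/
theorem convexHull_projMap {c : ℂ} {S : Set ℂ} (hS : ∀ u ∈ S, 0 < projDenom c u) {q : ℂ}
    (hq : q ∈ convexHull ℝ S) :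
    projNum c q / projDenom c q ∈ convexHull ℝ ((fun u => projNum c u / projDenom c u) '' S) := by
  set T := convexHull ℝ ((fun u => projNum c u / (projDenom c u : ℂ)) '' S)
  have hsub : S ⊆ {u | 0 < projDenom c u ∧ projNum c u / projDenom c u ∈ T} := fun u hu =>
    ⟨hS u hu, subset_convexHull ℝ _ (Set.mem_image_of_mem _ hu)⟩
  refine (convexHull_min hsub ?_ hq).2
  rintro x ⟨hx, hxT⟩ y ⟨hy, hyT⟩ s t hs ht hst
  have hD : projDenom c (s • x + t • y) = s * projDenom c x + t * projDenom c y := by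
    simp only [projDenom, mul_add, Complex.add_re, Complex.real_smul, mul_left_comm (conj c),
      Complex.re_ofReal_mul]
    linear_combination (-(1 + Complex.normSq c)) * hst
  have hN : projNum c (s • x + t • y) = s * projNum c x + t * projNum c y := by
    have h : (s : ℂ) + t = 1 := by exact_mod_cast hst
    simp only [projNum, map_add, map_mul, Complex.real_smul, Complex.conj_ofReal]
    linear_combination (2 * c) * h
  have hpos : 0 < projDenom c (s • x + t • y) := by
    rw [hD]
    rcases hs.eq_or_lt with rfl | hs
    · have : t = 1 := by linarith
      subst this
      simpa using hy
    · positivity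
  refine ⟨hpos, ?_⟩
  have hconv := (convex_convexHull ℝ ((fun u => projNum c u / (projDenom c u : ℂ)) '' S)) hxT hyT
    (a := s * projDenom c x / projDenom c (s • x + t • y))
    (b := t * projDenom c y / projDenom c (s • x + t • y)) (by positivity) (by positivity)
    (by rw [← add_div, ← hD, div_self hpos.ne'])
  convert hconv using 1
  have h1 : (projDenom c x : ℂ) ≠ 0 := by exact_mod_cast hx.ne'
  have h2 : (projDenom c y : ℂ) ≠ 0 := by exact_mod_cast hy.ne'
  have h3 : (projDenom c (s • x + t • y) : ℂ) ≠ 0 := by exact_mod_cast hpos.ne'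
  rw [hN]
  generalize projDenom c (s • x + t • y) = D at *
  rw [Complex.real_smul, Complex.real_smul]
  push_cast
  field_simp

/-- Put `A = (1 - x) * projDenom c z` and `B = x * projDenom c w`. The affine denominator is `A + B`
on the chord, and `normSq_diskMobius_sub` turns the other term into `4 * δ * A * B`, leaving `δ * (A
- B) ^ 2`. The double root is the tangency. -/
theorem conicForm_chord {δ : ℝ} {c z w : ℂ} (hc : ‖c‖ < 1) (hz : ‖z‖ = 1) (hw : ‖w‖ = 1)
    (h : Complex.normSq (diskMobius c z - diskMobius c w) = 4 * δ) (x : ℝ) :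
    conicForm δ c ((1 - x) * z + x * w) =
      δ * ((1 - x) * projDenom c z - x * projDenom c w) ^ 2 := by
  have h1 := normSq_diskMobius_sub hc hz hw
  rw [h] at h1
  have hD : projDenom c ((1 - x) * z + x * w) = (1 - x) * projDenom c z + x * projDenom c w := by
    simp only [projDenom, Complex.add_re, Complex.mul_re, Complex.mul_im, Complex.add_im,
      Complex.sub_re, Complex.sub_im, Complex.ofReal_re, Complex.ofReal_im, Complex.one_re,
      Complex.one_im]
    ring
  have hN : 1 - Complex.normSq ((1 - x) * z + x * w) = x * (1 - x) * Complex.normSq (z - w) := by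
    have e1 := normSq_eq_one hz
    have e2 := normSq_eq_one hw
    simp only [Complex.normSq_apply, Complex.add_re, Complex.mul_re, Complex.mul_im, Complex.add_im,
      Complex.sub_re, Complex.sub_im, Complex.ofReal_re, Complex.ofReal_im, Complex.one_re,
      Complex.one_im] at e1 e2 ⊢
    linear_combination (-(1 - x)) * e1 - x * e2
  rw [conicForm, hD, hN]
  linear_combination (-(x * (1 - x))) * h1

/-! ### Regular polygons on the unit circle. -/

/-- The primitive `n`-th root of unity `exp (2πi / n)`. -/
noncomputable def primRoot (n : ℕ) : ℂ := Complex.exp ((2 * (Real.pi / n) : ℝ) * Complex.I)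

theorem primRoot_eq (n : ℕ) : primRoot n = Complex.exp (2 * Real.pi * Complex.I / n) := by
  rw [primRoot]
  congr 1
  push_cast
  ring

theorem isPrimitiveRoot_primRoot {n : ℕ} (hn : n ≠ 0) : IsPrimitiveRoot (primRoot n) n := by
  rw [primRoot_eq]
  exact Complex.isPrimitiveRoot_exp n hn

theorem norm_primRoot (n : ℕ) : ‖primRoot n‖ = 1 := Complex.norm_exp_ofReal_mul_I _

theorem primRoot_pow (n k : ℕ) :
    primRoot n ^ k = Complex.exp ((2 * (k * (Real.pi / n)) : ℝ) * Complex.I) := by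
  rw [primRoot, ← Complex.exp_nat_mul]
  congr 1
  push_cast
  ring

/-- From `exp (2 i a) - 1 = 2 i sin a * exp (i a)`: orientations of vertices reduce to signs of
sines of half angles. -/
theorem im_conj_exp_sub_one_mul (a b : ℝ) :
    (conj (Complex.exp ((2 * a : ℝ) * Complex.I) - 1) *
      (Complex.exp ((2 * b : ℝ) * Complex.I) - 1)).im =
      4 * Real.sin a * Real.sin b * Real.sin (b - a) := by
  simp only [Complex.mul_im, Complex.conj_re, Complex.conj_im, Complex.sub_re, Complex.sub_im,
    Complex.exp_ofReal_mul_I_re, Complex.exp_ofReal_mul_I_im, Complex.one_re, Complex.one_im]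
  rw [Real.sin_sub, Real.cos_two_mul, Real.cos_two_mul, Real.sin_two_mul, Real.sin_two_mul]
  linear_combination (4 * Real.sin b * Real.cos b) * Real.sin_sq_add_cos_sq a -
    (4 * Real.sin a * Real.cos a) * Real.sin_sq_add_cos_sq b

theorem normSq_primRoot_sub_one (n : ℕ) :
    Complex.normSq (primRoot n - 1) = 4 * Real.sin (Real.pi / n) ^ 2 := by
  rw [primRoot]
  simp only [Complex.normSq_apply, Complex.sub_re, Complex.sub_im,
    Complex.exp_ofReal_mul_I_re, Complex.exp_ofReal_mul_I_im, Complex.one_re, Complex.one_im]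
  rw [Real.cos_two_mul, Real.sin_two_mul]
  linear_combination (4 * Real.cos (Real.pi / n) ^ 2 - 4) *
    Real.sin_sq_add_cos_sq (Real.pi / n)

theorem im_conj_rotate {ζ : ℂ} (hζ : ‖ζ‖ = 1) (x y : ℂ) :
    (conj (ζ * x - ζ) * (ζ * y - ζ)).im = (conj (x - 1) * (y - 1)).im := by
  congr 1
  simp only [map_sub, map_mul, map_one]
  linear_combination ((conj x - 1) * (y - 1)) * conj_mul_self_of_norm_eq_one hζ

theorem norm_eq_one_of_pow {n : ℕ} (hn : n ≠ 0) {ζ μ : ℂ} (hμ : ‖μ‖ = 1) (h : ζ ^ n = μ) :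
    ‖ζ‖ = 1 := by
  have : ‖ζ‖ ^ n = 1 := by rw [← norm_pow, h, hμ]
  exact (pow_eq_one_iff_of_nonneg (norm_nonneg _) hn).mp this

theorem exists_eq_mul_primRoot_pow {n : ℕ} (hn : n ≠ 0) {ζ v μ : ℂ} (hζ : ‖ζ‖ = 1)
    (h : ζ ^ n = μ) (hv : v ^ n = μ) : ∃ k < n, v = ζ * primRoot n ^ k := by
  have hζ0 : ζ ≠ 0 := by rintro rfl; simp at hζ
  have : NeZero n := ⟨hn⟩
  have h1 : (v / ζ) ^ n = 1 := by rw [div_pow, h, hv, div_self (h ▸ pow_ne_zero n hζ0)]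
  obtain ⟨k, hk, hk'⟩ := (isPrimitiveRoot_primRoot hn).eq_pow_of_pow_eq_one h1
  exact ⟨k, hk, by rw [hk']; field_simp⟩

theorem nat_mul_pi_div_lt_pi {n k : ℕ} (hk : k < n) : k * (Real.pi / n) < Real.pi := by
  have hn : (0 : ℝ) < n := by exact_mod_cast (Nat.zero_le k).trans_lt hk
  have hk' : (k : ℝ) < n := by exact_mod_cast hk
  rw [mul_div_assoc', div_lt_iff₀ hn, mul_comm]
  exact mul_lt_mul_of_pos_left hk' Real.pi_pos

/-- In the regular polygon formed by the `n`-th roots of `μ`, each vertex `ζ` is followed by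
`ζ * exp (2πi / n)`. -/
theorem im_conj_primRoot_nonneg {n : ℕ} (hn : 2 ≤ n) {ζ v μ : ℂ} (hζ : ‖ζ‖ = 1)
    (h : ζ ^ n = μ) (hv : v ^ n = μ) :
    0 ≤ (conj (ζ * primRoot n - ζ) * (v - ζ)).im := by
  obtain ⟨k, hk, rfl⟩ := exists_eq_mul_primRoot_pow (by omega) hζ h hv
  have hpos : 0 < Real.pi / n := by
    have : (0 : ℝ) < n := by exact_mod_cast (by omega : 0 < n)
    have := Real.pi_pos
    positivity
  have h1 := nat_mul_pi_div_lt_pi (n := n) (k := 1) (by omega)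
  rw [Nat.cast_one, one_mul] at h1
  rw [im_conj_rotate hζ, primRoot_pow, primRoot, im_conj_exp_sub_one_mul]
  rcases k with _ | k
  · simp
  · have h2 := nat_mul_pi_div_lt_pi hk
    have e : ((k + 1 : ℕ) : ℝ) * (Real.pi / n) - Real.pi / n = k * (Real.pi / n) := by
      push_cast; ring
    have h3 := nat_mul_pi_div_lt_pi (k.lt_succ_self.trans hk)
    have s1 := Real.sin_nonneg_of_nonneg_of_le_pi hpos.le h1.le
    have s2 := Real.sin_nonneg_of_nonneg_of_le_pi (by positivity) h2.le
    have s3 := Real.sin_nonneg_of_nonneg_of_le_pi (by positivity) h3.le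
    rw [e]
    positivity

theorem eq_mul_primRoot_of_im_nonneg {n : ℕ} (hn : 2 ≤ n) {ζ ξ μ : ℂ} (hζ : ‖ζ‖ = 1)
    (h : ζ ^ n = μ) (hξ : ξ ^ n = μ) (hne : ζ ≠ ξ)
    (hv : ∀ v, v ^ n = μ → 0 ≤ (conj (ξ - ζ) * (v - ζ)).im) : ξ = ζ * primRoot n := by
  obtain ⟨k, hk, rfl⟩ := exists_eq_mul_primRoot_pow (by omega) hζ h hξ
  have hpos : 0 < Real.pi / n := by
    have : (0 : ℝ) < n := by exact_mod_cast (by omega : 0 < n)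
    have := Real.pi_pos
    positivity
  have h1 := nat_mul_pi_div_lt_pi (n := n) (k := 1) (by omega)
  rw [Nat.cast_one, one_mul] at h1
  -- The vertex right after `ζ` is the test: it lies strictly to the right of the line from `ζ` to
  -- `ζ * primRoot n ^ k` once `k ≥ 2`.
  have h2 := hv (ζ * primRoot n) (by
    rw [mul_pow, (isPrimitiveRoot_primRoot (by omega)).pow_eq_one, mul_one, h])
  rw [im_conj_rotate hζ, primRoot_pow, primRoot, im_conj_exp_sub_one_mul] at h2
  rcases k with _ | _ | k
  · simp at hne
  · simp
  · exfalso
    have h3 := nat_mul_pi_div_lt_pi hk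
    have h4 := nat_mul_pi_div_lt_pi (k := k + 1) (by omega : k + 1 < n)
    have e : Real.pi / n - ((k + 1 + 1 : ℕ) : ℝ) * (Real.pi / n) =
        -(((k + 1 : ℕ) : ℝ) * (Real.pi / n)) := by
      push_cast; ring
    have s1 := Real.sin_pos_of_pos_of_lt_pi hpos h1
    have s2 := Real.sin_pos_of_pos_of_lt_pi (by positivity) h3
    have s3 := Real.sin_pos_of_pos_of_lt_pi (by positivity) h4
    rw [e, Real.sin_neg] at h2
    have := mul_pos (mul_pos (mul_pos (by norm_num : (0 : ℝ) < 4) s2) s1) s3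
    linarith

theorem exists_pow_eq_re_ge {n : ℕ} (hn : n ≠ 0) {μ : ℂ} (hμ : ‖μ‖ = 1) (e : ℂ) :
    ∃ v : ℂ, v ^ n = μ ∧ ‖e‖ * Real.cos (Real.pi / n) ≤ (conj e * v).re := by
  obtain ⟨ν, hν⟩ := IsAlgClosed.exists_pow_nat_eq μ (Nat.pos_of_ne_zero hn)
  have hν1 := norm_eq_one_of_pow hn hμ hν
  have hn0 : (0 : ℝ) < n := by exact_mod_cast Nat.pos_of_ne_zero hn
  have hpi := Real.pi_pos
  -- Rotating by the nearest multiple of `2π / n` brings the root within angle `π / n` of the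
  -- direction of `e`.
  set θ := Complex.arg (conj e * ν) with hθ
  set k := round (θ / (2 * Real.pi / n)) with hk
  refine ⟨ν * Complex.exp ((-(k * (2 * Real.pi / n)) : ℝ) * Complex.I), ?_, ?_⟩
  · rw [mul_pow, hν, ← Complex.exp_nat_mul]
    have : (n : ℂ) * ((-(k * (2 * Real.pi / n)) : ℝ) * Complex.I) =
        ((-k : ℤ) : ℂ) * (2 * Real.pi * Complex.I) := by
      have : (n : ℂ) ≠ 0 := by exact_mod_cast hn
      push_cast
      field_simp
    rw [this, Complex.exp_int_mul_two_pi_mul_I, mul_one]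
  · rw [← mul_assoc, ← Complex.norm_mul_exp_arg_mul_I (conj e * ν), ← hθ, mul_assoc,
      ← Complex.exp_add, ← add_mul, ← Complex.ofReal_add, Complex.re_ofReal_mul,
      Complex.exp_ofReal_mul_I_re, norm_mul, hν1, mul_one, Complex.norm_conj]
    refine mul_le_mul_of_nonneg_left ?_ (norm_nonneg _)
    rw [← Real.cos_abs (θ + _)]
    have habs : |θ + -(k * (2 * Real.pi / n))| ≤ Real.pi / n := by
      have h1 := abs_sub_round (θ / (2 * Real.pi / n))
      rw [← hk] at h1
      have h2 : θ + -(k * (2 * Real.pi / n)) =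
          (θ / (2 * Real.pi / n) - k) * (2 * Real.pi / n) := by
        field_simp
        ring
      rw [h2, abs_mul, abs_of_pos (by positivity : 0 < 2 * Real.pi / n)]
      calc _ ≤ 1 / 2 * (2 * Real.pi / n) := by gcongr
        _ = _ := by ring
    refine Real.cos_le_cos_of_nonneg_of_le_pi (abs_nonneg _) ?_ habs
    rw [div_le_iff₀ hn0]
    have : (1 : ℝ) ≤ n := by exact_mod_cast Nat.one_le_iff_ne_zero.mpr hn
    nlinarith

/-- A regular polygon contains its inscribed disk. -/
theorem mem_convexHull_of_norm_le_cos {n : ℕ} (hn : n ≠ 0) {μ : ℂ} (hμ : ‖μ‖ = 1) {q : ℂ}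
    (hq : ‖q‖ ≤ Real.cos (Real.pi / n)) : q ∈ convexHull ℝ {v : ℂ | v ^ n = μ} := by
  by_contra hnot
  have hfin : {v : ℂ | v ^ n = μ}.Finite := by
    refine (Polynomial.nthRoots n μ).toFinset.finite_toSet.subset fun v hv => ?_
    simpa [Polynomial.mem_nthRoots (Nat.pos_of_ne_zero hn)] using hv
  obtain ⟨f, u, h1, h2⟩ := geometric_hahn_banach_closed_point (convex_convexHull ℝ _)
    (hfin.isClosed_convexHull ℝ) hnot
  -- The separating functional is `v ↦ Re (conj e * v)`; some vertex takes a value at least `‖e‖ *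
  -- cos (π / n)`, which bounds its value at `q`.
  set e : ℂ := ⟨f 1, f Complex.I⟩ with he
  have hf : ∀ v, f v = (conj e * v).re := by
    intro v
    have : v = v.re • (1 : ℂ) + v.im • Complex.I := by simp
    conv_lhs => rw [this, map_add, map_smul, map_smul]
    simp [he, Complex.mul_re]
    ring
  obtain ⟨v, hv, hge⟩ := exists_pow_eq_re_ge hn hμ e
  have h3 := h1 v (subset_convexHull ℝ _ hv)
  rw [hf] at h2 h3
  have h4 := Complex.re_le_norm (conj e * q)
  rw [norm_mul, Complex.norm_conj] at h4
  nlinarith [mul_le_mul_of_nonneg_left hq (norm_nonneg e)]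

/-- A point at distance `|cos (π / n)|` from `0` is the midpoint of the chord with endpoints at
angles `∓π / n` from a suitable unit vector. When the cosine is `0`, any direction serves. -/
theorem exists_mem_segment_primRoot {n : ℕ} {q : ℂ}
    (hq : Complex.normSq q = Real.cos (Real.pi / n) ^ 2) :
    ∃ u : ℂ, ‖u‖ = 1 ∧ q ∈ segment ℝ u (u * primRoot n) := by
  obtain ⟨e, he, rfl⟩ : ∃ e : ℂ, ‖e‖ = 1 ∧ q = e * (Real.cos (Real.pi / n) : ℂ) := by
    by_cases hcos : Real.cos (Real.pi / n) = 0
    · rw [hcos] at hq ⊢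
      exact ⟨1, norm_one, by simpa using hq⟩
    · refine ⟨q / (Real.cos (Real.pi / n) : ℂ), ?_, ?_⟩
      · apply norm_eq_one_of_normSq
        rw [Complex.normSq_div, hq, Complex.normSq_ofReal, ← pow_two, div_self (pow_ne_zero 2 hcos)]
      · rw [div_mul_cancel₀]
        exact_mod_cast hcos
  refine ⟨e * Complex.exp ((-(Real.pi / n) : ℝ) * Complex.I), ?_, ?_⟩
  · rw [norm_mul, he, Complex.norm_exp_ofReal_mul_I, one_mul]
  · refine ⟨1 / 2, 1 / 2, by norm_num, by norm_num, by norm_num, ?_⟩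
    rw [primRoot, mul_assoc, ← Complex.exp_add, ← add_mul, ← Complex.ofReal_add, Complex.real_smul,
      Complex.real_smul, Complex.ofReal_cos, Complex.cos]
    have e1 : ((-(Real.pi / n) + 2 * (Real.pi / n) : ℝ) : ℂ) * Complex.I =
      ((Real.pi / n : ℝ) : ℂ) * Complex.I := by push_cast; ring
    rw [e1]
    push_cast
    ring

/-! ### The conic as a convex curve and its tangents. -/

theorem norm_le_one_of_conicForm_nonpos {δ : ℝ} (hδ : 0 ≤ δ) {c z : ℂ} (hc : ‖c‖ < 1)
    (h : conicForm δ c z ≤ 0) : ‖z‖ ≤ 1 := by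
  have h1 := sq_pos_of_pos (sub_pos.mpr (normSq_lt_one hc))
  have h2 : 0 ≤ δ * projDenom c z ^ 2 := by positivity
  have h3 : 0 ≤ 1 - Complex.normSq z := by
    by_contra! h3
    have := mul_neg_of_pos_of_neg h1 h3
    rw [conicForm] at h
    linarith
  rw [Complex.normSq_eq_norm_sq] at h3
  nlinarith [norm_nonneg z]

theorem norm_lt_one_of_conicForm_nonpos {δ : ℝ} (hδ : 0 < δ) {c z : ℂ} (hc : ‖c‖ < 1)
    (h : conicForm δ c z ≤ 0) : ‖z‖ < 1 := by
  have h1 := norm_le_one_of_conicForm_nonpos hδ.le hc h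
  refine lt_of_le_of_ne h1 fun h2 => ?_
  have h3 := projDenom_pos hc h1
  rw [conicForm, normSq_eq_one h2, sub_self, mul_zero, sub_zero] at h
  have : 0 < δ * projDenom c z ^ 2 := by positivity
  linarith

theorem conicForm_combo (δ : ℝ) (c x y : ℂ) {s t : ℝ} (h : s + t = 1) :
    conicForm δ c (s • x + t • y) =
      s * conicForm δ c x + t * conicForm δ c y - s * t * conicPolar δ c (x - y) (x - y) := by
  obtain rfl : t = 1 - s := by linarith
  simp only [conicForm, conicPolar, projDenom, Complex.normSq_apply, Complex.sub_re,
    Complex.sub_im, Complex.add_re, Complex.add_im, Complex.mul_re, Complex.mul_im, Complex.conj_re,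
    Complex.conj_im, Complex.real_smul, Complex.ofReal_re, Complex.ofReal_im]
  ring

theorem convex_conicForm_nonpos {δ : ℝ} (hδ : 0 ≤ δ) (c : ℂ) :
    Convex ℝ {z | conicForm δ c z ≤ 0} := by
  intro x hx y hy s t hs ht hst
  have hx : conicForm δ c x ≤ 0 := hx
  have hy : conicForm δ c y ≤ 0 := hy
  change conicForm δ c (s • x + t • y) ≤ 0
  rw [conicForm_combo δ c x y hst]
  have h1 := mul_nonneg (mul_nonneg hs ht) (conicPolar_self_nonneg hδ c (x - y))
  have h2 := mul_nonpos_of_nonneg_of_nonpos hs hx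
  have h3 := mul_nonpos_of_nonneg_of_nonpos ht hy
  linarith

theorem isCompact_conicForm_nonpos {δ : ℝ} (hδ : 0 ≤ δ) {c : ℂ} (hc : ‖c‖ < 1) :
    IsCompact {z | conicForm δ c z ≤ 0} := by
  refine (isCompact_closedBall (0 : ℂ) 1).of_isClosed_subset
    (isClosed_le (continuous_conicForm δ c) continuous_const) fun z hz => ?_
  rw [mem_closedBall_zero_iff]
  exact norm_le_one_of_conicForm_nonpos hδ hc hz

theorem frontier_conicForm_nonpos {δ : ℝ} (hδ : 0 ≤ δ) {c : ℂ} (hc : ‖c‖ < 1) :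
    frontier {z | conicForm δ c z ≤ 0} = {z | conicForm δ c z = 0} := by
  refine (frontier_le_subset_eq (continuous_conicForm δ c) continuous_const).antisymm ?_
  intro p hp
  have hp : conicForm δ c p = 0 := hp
  refine ⟨subset_closure hp.le, fun hint => ?_⟩
  obtain ⟨ε, hε, hball⟩ := Metric.isOpen_iff.mp isOpen_interior p hint
  have hmem : ∀ v : ℂ, ‖v‖ < ε → conicForm δ c (p + v) ≤ 0 := fun v hv =>
    interior_subset (s := {z | conicForm δ c z ≤ 0}) (hball (a := p + v)
      (by rwa [Metric.mem_ball, dist_eq_norm, add_sub_cancel_left]))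
  have hnorm : ‖((ε / 2 : ℝ) : ℂ)‖ < ε := by
    rw [Complex.norm_real, Real.norm_of_nonneg (by positivity)]; linarith
  -- Adding the expansions at `p + v` and `p - v` cancels the gradient and leaves the positive
  -- quadratic part, which cannot be nonpositive.
  have h1 := hmem _ hnorm
  have h2 := hmem (-((ε / 2 : ℝ) : ℂ)) (by rwa [norm_neg])
  have h3 := conicPolar_self_pos hδ hc (v := ((ε / 2 : ℝ) : ℂ)) (by exact_mod_cast (by positivity))
  have h4 : conicPolar δ c (-((ε / 2 : ℝ) : ℂ)) (-((ε / 2 : ℝ) : ℂ)) =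
      conicPolar δ c ((ε / 2 : ℝ) : ℂ) ((ε / 2 : ℝ) : ℂ) := by
    simp [conicPolar_self]
  rw [conicForm_add, hp] at h1 h2
  rw [h4, mul_neg, Complex.neg_re] at h2
  linarith

/-- Multiply the exact expansion at `p + d k` by `t k`: bilinearity absorbs the factor, and the
quadratic term tends to `0` because `d k` does while `t k • d k` stays convergent. -/
theorem re_conj_conicGrad_mul_eq_zero {δ : ℝ} {c p v : ℂ} (hp : conicForm δ c p = 0)
    (hv : v ∈ tangentConeAt ℝ {z | conicForm δ c z = 0} p) :
    (conj (conicGrad δ c p) * v).re = 0 := by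
  obtain ⟨t, d, hd, hmem, hlim⟩ := mem_tangentConeAt_iff_exists_seq.mp hv
  have hcont : Continuous fun x : ℂ × ℂ =>
      (conj (conicGrad δ c p) * x.2).re + conicPolar δ c x.1 x.2 := by
    unfold conicPolar
    fun_prop
  have h1 := (hcont.tendsto (0, v)).comp (hd.prodMk_nhds hlim)
  have h2 : (conj (conicGrad δ c p) * v).re + conicPolar δ c 0 v =
      (conj (conicGrad δ c p) * v).re := by
    simp [conicPolar]
  simp only [h2] at h1
  refine tendsto_nhds_unique h1 (tendsto_const_nhds.congr' ?_)
  filter_upwards [hmem] with k hk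
  have hk : conicForm δ c (p + d k) = 0 := hk
  rw [conicForm_add, hp, zero_add] at hk
  have h3 : conicPolar δ c (d k) (t k • d k) = t k * conicPolar δ c (d k) (d k) := by
    simp only [conicPolar, Complex.real_smul, mul_left_comm _ (t k : ℂ), Complex.re_ofReal_mul]
    ring
  simp only [Function.comp_apply, h3]
  rw [Complex.real_smul, mul_left_comm, Complex.re_ofReal_mul, ← mul_add, hk, mul_zero]

theorem exists_real_mul_of_orthogonal {g v d : ℂ} (hg : g ≠ 0) (hd : d ≠ 0)
    (h1 : (conj g * v).re = 0) (h2 : (conj g * d).re = 0) : ∃ t : ℝ, v = t * d := by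
  have hg' : g.re ≠ 0 ∨ g.im ≠ 0 := by
    by_contra! h
    exact hg (Complex.ext h.1 h.2)
  have hd' := Complex.normSq_pos.mpr hd
  simp only [Complex.mul_re, Complex.conj_re, Complex.conj_im] at h1 h2
  have h3 : v.re * d.im = v.im * d.re := by
    rcases hg' with h | h
    · exact mul_left_cancel₀ h (by linear_combination d.im * h1 - v.im * h2)
    · exact mul_left_cancel₀ h (by linear_combination -d.re * h1 + v.re * h2)
  rw [Complex.normSq_apply] at hd'
  refine ⟨(v.re * d.re + v.im * d.im) / (d.re * d.re + d.im * d.im), Complex.ext ?_ ?_⟩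
  · rw [Complex.re_ofReal_mul, div_mul_eq_mul_div, eq_div_iff hd'.ne']
    linear_combination d.im * h3
  · rw [Complex.im_ofReal_mul, div_mul_eq_mul_div, eq_div_iff hd'.ne']
    linear_combination -d.re * h3

theorem conicForm_zero_set_of_grad {δ : ℝ} (hδ : 0 ≤ δ) {c p : ℂ} (hc : ‖c‖ < 1)
    (hp : conicForm δ c p = 0) (hg : conicGrad δ c p = 0) : {z | conicForm δ c z = 0} = {p} := by
  ext z
  refine ⟨fun hz => ?_, fun hz => by rw [Set.mem_singleton_iff.mp hz]; exact hp⟩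
  by_contra hne
  have hz : conicForm δ c z = 0 := hz
  have h1 := conicForm_add δ c p (z - p)
  rw [add_sub_cancel, hz, hp, hg, map_zero, zero_mul, Complex.zero_re] at h1
  have := conicPolar_self_pos hδ hc (sub_ne_zero.mpr hne)
  linarith

/-- The conic touches each chord of the unit circle that corresponds to a chord of length `2 √δ`. -/
theorem exists_segmentTangentAt {δ : ℝ} (hδ : 0 < δ) {c z w : ℂ} (hc : ‖c‖ < 1) (hz : ‖z‖ = 1)
    (hw : ‖w‖ = 1) (h : Complex.normSq (diskMobius c z - diskMobius c w) = 4 * δ) :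
    ∃ p, SegmentTangentAt {z | conicForm δ c z = 0} z w p := by
  have hchord := conicForm_chord hc hz hw h
  have hne : w - z ≠ 0 := by
    intro h0
    rw [sub_eq_zero.mp h0, sub_self, map_zero] at h
    linarith
  have hLz := projDenom_pos hc hz.le
  have hLw := projDenom_pos hc hw.le
  -- The double root in `conicForm_chord`.
  set x := projDenom c z / (projDenom c z + projDenom c w) with hx
  have hx1 : x * (projDenom c z + projDenom c w) = projDenom c z := by
    rw [hx, div_mul_cancel₀]; positivity
  have hx2 : (1 - x) * projDenom c z - x * projDenom c w = 0 := by linear_combination -hx1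
  have hx0 : 0 ≤ x := by positivity
  have hx3 : x ≤ 1 := by rw [hx, div_le_one (by positivity)]; linarith
  set p : ℂ := (1 - x) * z + x * w with hp
  have hp0 : conicForm δ c p = 0 := by
    have := hchord x
    rw [hx2] at this
    rw [this]
    ring
  -- The form is quadratic along the chord, so the central difference at parameters `x ± 1` is its
  -- exact derivative at the double root.
  have hdir : (conj (conicGrad δ c p) * (w - z)).re = 0 := by
    have e1 := hchord (x + 1)
    have e2 := hchord (x - 1)
    have f1 : (1 - ((x + 1 : ℝ) : ℂ)) * z + ((x + 1 : ℝ) : ℂ) * w = p + (w - z) := by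
      rw [hp]; push_cast; ring
    have f2 : (1 - ((x - 1 : ℝ) : ℂ)) * z + ((x - 1 : ℝ) : ℂ) * w = p + -(w - z) := by
      rw [hp]; push_cast; ring
    have f3 : conicPolar δ c (-(w - z)) (-(w - z)) = conicPolar δ c (w - z) (w - z) := by
      rw [conicPolar_self, conicPolar_self, mul_neg, Complex.neg_re, Complex.normSq_neg]; ring
    rw [f1, conicForm_add] at e1
    rw [f2, conicForm_add, f3, mul_neg, Complex.neg_re] at e2
    linear_combination (e1 - e2) / 2 - 2 * δ * (projDenom c z + projDenom c w) * hx2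
  refine ⟨p, ?_, fun v hv => ?_⟩
  · ext y
    constructor
    · rintro ⟨hy, s, t, hs, ht, hst, rfl⟩
      obtain rfl : s = 1 - t := by linarith
      have e : (1 - t) • z + t • w = (1 - (t : ℂ)) * z + t * w := by
        simp [Complex.real_smul]
      have hy : conicForm δ c ((1 - t) • z + t • w) = 0 := hy
      rw [e, hchord t, mul_eq_zero, pow_eq_zero_iff two_ne_zero] at hy
      have hy := hy.resolve_left hδ.ne'
      have : t = x := by
        rw [hx, eq_div_iff (by positivity)]
        linarith
      rw [Set.mem_singleton_iff, e, this, hp]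
    · rintro rfl
      refine ⟨hp0, 1 - x, x, by linarith, hx0, by ring, ?_⟩
      rw [hp]
      simp [Complex.real_smul]
  -- A vanishing gradient is the degenerate case: the conic is one point and its tangent cone
  -- contains only `0`.
  · by_cases hg : conicGrad δ c p = 0
    · rw [conicForm_zero_set_of_grad hδ.le hc hp0 hg] at hv
      refine ⟨0, ?_⟩
      obtain ⟨t, d, -, hmem, hlim⟩ := mem_tangentConeAt_iff_exists_seq.mp hv
      rw [Complex.ofReal_zero, zero_mul]
      refine tendsto_nhds_unique hlim (tendsto_const_nhds.congr' ?_)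
      filter_upwards [hmem] with k hk
      rw [Set.mem_singleton_iff, add_eq_left] at hk
      rw [hk, smul_zero]
    · exact exists_real_mul_of_orthogonal hg hne (re_conj_conicGrad_mul_eq_zero hp0 hv) hdir

/-! ### The degenerate conic and the foci of the ellipse. -/

/-- The point is the preimage of `0` under the projective map. It shows that the region bounded by
the conic is nonempty, and it is the whole conic when `δ = 1`. -/
theorem conicForm_center (δ : ℝ) (c : ℂ) :
    conicForm δ c ((2 / (1 + Complex.normSq c) : ℝ) * c) =
      (δ - 1) * (1 - Complex.normSq c) ^ 4 / (1 + Complex.normSq c) ^ 2 := by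
  have h := Complex.normSq_nonneg c
  have h1 : (conj c * ((2 / (1 + Complex.normSq c) : ℝ) * c)).re =
      2 / (1 + Complex.normSq c) * Complex.normSq c := by
    rw [mul_left_comm, mul_comm (conj c), Complex.mul_conj, ← Complex.ofReal_mul, Complex.ofReal_re]
  rw [conicForm, projDenom, h1, Complex.normSq_mul, Complex.normSq_ofReal]
  generalize Complex.normSq c = r at *
  field_simp
  ring

theorem conicGrad_center (c : ℂ) :
    conicGrad 1 c ((2 / (1 + Complex.normSq c) : ℝ) * c) = 0 := by
  have h := Complex.normSq_nonneg c
  have h1 : (conj c * ((2 / (1 + Complex.normSq c) : ℝ) * c)).re =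
      2 / (1 + Complex.normSq c) * Complex.normSq c := by
    rw [mul_left_comm, mul_comm (conj c), Complex.mul_conj, ← Complex.ofReal_mul, Complex.ofReal_re]
  rw [conicGrad, projDenom, h1, ← mul_assoc, ← Complex.ofReal_mul, ← sub_mul,
    ← Complex.ofReal_sub]
  generalize Complex.normSq c = r at *
  have : 2 * (1 - r) ^ 2 * (2 / (1 + r)) - 4 * 1 * (1 + r - 2 * (2 / (1 + r) * r)) = 0 := by
    field_simp
    ring
  rw [this, Complex.ofReal_zero, zero_mul]

/-- Squaring `A + B = s` twice only introduces factors that are positive here, and leaves an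
equation in the squared distances. -/
theorem add_eq_iff_of_abs_sub_lt {A B s : ℝ} (hA : 0 ≤ A) (hB : 0 ≤ B) (h : |A - B| < s) :
    A + B = s ↔ s ^ 4 - 2 * (A ^ 2 + B ^ 2) * s ^ 2 + (A ^ 2 - B ^ 2) ^ 2 = 0 := by
  have hs : 0 < s := (abs_nonneg _).trans_lt h
  have h1 : (A - B) ^ 2 < s ^ 2 := sq_lt_sq.mpr (by rwa [abs_of_pos hs])
  have h2 : s ^ 4 - 2 * (A ^ 2 + B ^ 2) * s ^ 2 + (A ^ 2 - B ^ 2) ^ 2 =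
      (s - (A + B)) * ((s + (A + B)) * (s ^ 2 - (A - B) ^ 2)) := by ring
  have h3 : 0 < (s + (A + B)) * (s ^ 2 - (A - B) ^ 2) := mul_pos (by linarith) (by linarith)
  rw [h2, mul_eq_zero, or_iff_left h3.ne', sub_eq_zero, eq_comm]

theorem isEllipse_conicForm {δ : ℝ} (hδ : 0 ≤ δ) (hδ1 : δ < 1) {c : ℂ} (hc : ‖c‖ < 1) :
    IsEllipse {z | conicForm δ c z = 0} := by
  have hρ := normSq_lt_one hc
  have hρ0 := Complex.normSq_nonneg c
  obtain ⟨ρ, hρe⟩ : ∃ ρ, ρ = Complex.normSq c := ⟨_, rfl⟩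
  rw [← hρe] at hρ hρ0
  -- The quadratic part of the form has eigenvalues `E` along `c` and `(1 - ρ) ^ 2` across it. So
  -- the center is `m * c`, the major axis, of length `s`, is perpendicular to `c`, and the foci are
  -- `c * (m ± i k)`.
  obtain ⟨E, hE⟩ : ∃ E, E = (1 - ρ) ^ 2 + 4 * δ * ρ := ⟨_, rfl⟩
  have hκ := sub_pos.mpr hρ
  have hδ2 := sub_pos.mpr hδ1
  have hE0 : 0 < E := by rw [hE]; positivity
  obtain ⟨s, hs0, hs⟩ : ∃ s, 0 < s ∧ s ^ 2 = 4 * (1 - δ) * (1 - ρ) ^ 2 / E := by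
    refine ⟨√(4 * (1 - δ) * (1 - ρ) ^ 2 / E), ?_, ?_⟩
    · rw [Real.sqrt_pos]; positivity
    · rw [Real.sq_sqrt (by positivity)]
  obtain ⟨k, hk⟩ : ∃ k, k ^ 2 = s ^ 2 * δ / E :=
    ⟨√(s ^ 2 * δ / E), Real.sq_sqrt (by positivity)⟩
  obtain ⟨m, hm⟩ : ∃ m, m = 2 * δ * (1 + ρ) / E := ⟨_, rfl⟩
  have hdist : dist (c * ⟨m, k⟩) (c * ⟨m, -k⟩) < s := by
    rw [dist_eq_norm]
    refine lt_of_pow_lt_pow_left₀ 2 hs0.le ?_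
    have e : c * (⟨m, k⟩ : ℂ) - c * ⟨m, -k⟩ = c * ⟨0, 2 * k⟩ := by
      rw [← mul_sub]
      congr 1
      apply Complex.ext <;> simp
      ring
    rw [e, ← Complex.normSq_eq_norm_sq, Complex.normSq_mul, ← hρe, Complex.normSq_mk]
    have : ρ * (0 * 0 + 2 * k * (2 * k)) = s ^ 2 * (4 * δ * ρ / E) := by
      linear_combination (4 * ρ) * hk
    rw [this]
    refine mul_lt_of_lt_one_right (by positivity) ((div_lt_one hE0).mpr ?_)
    rw [hE]
    have : 0 < (1 - ρ) ^ 2 := by positivity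
    linarith
  refine ⟨c * ⟨m, k⟩, c * ⟨m, -k⟩, s, hdist, ?_⟩
  ext z
  change conicForm δ c z = 0 ↔ dist z _ + dist z _ = s
  have habs : |dist z (c * ⟨m, k⟩) - dist z (c * ⟨m, -k⟩)| < s := by
    refine lt_of_le_of_lt ?_ hdist
    rw [dist_comm z, dist_comm z]
    exact abs_dist_sub_le _ _ _
  rw [add_eq_iff_of_abs_sub_lt dist_nonneg dist_nonneg habs]
  obtain ⟨X, hX⟩ : ∃ X, X = (conj c * z).re := ⟨_, rfl⟩
  obtain ⟨Y, hY⟩ : ∃ Y, Y = (conj c * z).im := ⟨_, rfl⟩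
  obtain ⟨N, hN⟩ : ∃ N, N = Complex.normSq z := ⟨_, rfl⟩
  have hXY : X ^ 2 + Y ^ 2 = ρ * N := by
    rw [hX, hY, hN, hρe, ← Complex.normSq_conj c, ← Complex.normSq_mul, Complex.normSq_apply]
    ring
  have hd : ∀ j : ℝ, dist z (c * ⟨m, j⟩) ^ 2 =
      N - 2 * (m * X + j * Y) + ρ * (m ^ 2 + j ^ 2) := by
    intro j
    rw [dist_eq_norm, ← Complex.normSq_eq_norm_sq, hN, hX, hY, hρe]
    simp only [Complex.normSq_apply, Complex.sub_re, Complex.sub_im, Complex.mul_re,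
      Complex.mul_im, Complex.conj_re, Complex.conj_im]
    ring
  have hform : conicForm δ c z = δ * (1 + ρ - 2 * X) ^ 2 - (1 - ρ) ^ 2 * (1 - N) := by
    rw [conicForm, projDenom, hX, hN, hρe]
  have key : s ^ 4 - 2 * (dist z (c * ⟨m, k⟩) ^ 2 + dist z (c * ⟨m, -k⟩) ^ 2) * s ^ 2 +
      (dist z (c * ⟨m, k⟩) ^ 2 - dist z (c * ⟨m, -k⟩) ^ 2) ^ 2 =
      -(4 * s ^ 2 / E) * conicForm δ c z := by
    rw [hd, hd, hform]
    have e : s ^ 2 - 4 * (N - 2 * m * X + ρ * (m ^ 2 + s ^ 2 * δ / E)) + 16 * (δ / E) * Y ^ 2 =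
        -(4 / E) * (δ * (1 + ρ - 2 * X) ^ 2 - (1 - ρ) ^ 2 * (1 - N)) := by
      have hY2 : Y ^ 2 = ρ * N - X ^ 2 := by linarith
      rw [hY2, hs, hm]
      field_simp
      rw [hE]
      ring
    linear_combination s ^ 2 * e + (16 * Y ^ 2 - 4 * s ^ 2 * ρ) * hk
  rw [key, mul_eq_zero, or_iff_right]
  exact neg_ne_zero.mpr (by positivity)

/-! ### Transport from regular polygons to the polygons of `B`. -/

theorem im_conj_mul_diskMobius_nonneg_iff {c z w v : ℂ} (hc : ‖c‖ < 1) (hz : ‖z‖ = 1)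
    (hw : ‖w‖ = 1) (hv : ‖v‖ = 1) :
    0 ≤ (conj (diskMobius c w - diskMobius c z) * (diskMobius c v - diskMobius c z)).im ↔
      0 ≤ (conj (w - z) * (v - z)).im := by
  have h := im_conj_mul_diskMobius hc hz hw hv
  have h1 : 0 < projDenom c z * projDenom c w * projDenom c v :=
    mul_pos (mul_pos (projDenom_pos hc hz.le) (projDenom_pos hc hw.le)) (projDenom_pos hc hv.le)
  have h2 : 0 < (1 - Complex.normSq c) ^ 3 := pow_pos (sub_pos.mpr (normSq_lt_one hc)) 3
  rw [← mul_nonneg_iff_of_pos_right h1, h, mul_nonneg_iff_of_pos_right h2]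

/-- The sides of the polygon whose vertices are carried to the `n`-th roots of `μ` by `diskMobius c`
join vertices carried to consecutive roots. -/
theorem isPolygonSide_iff {n : ℕ} (hn : 2 ≤ n) {c μ : ℂ} (hc : ‖c‖ < 1) (hμ : ‖μ‖ = 1) {V : Set ℂ}
    (hV : ∀ z, z ∈ V ↔ ‖z‖ = 1 ∧ diskMobius c z ^ n = μ) {z w : ℂ} :
    IsPolygonSide V z w ↔ z ∈ V ∧ w ∈ V ∧ diskMobius c w = diskMobius c z * primRoot n := by
  have hc' : ‖-c‖ < 1 := by rwa [norm_neg]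
  constructor
  · rintro ⟨hz, hw, hne, hall⟩
    refine ⟨hz, hw, ?_⟩
    obtain ⟨hz1, hzn⟩ := (hV z).mp hz
    obtain ⟨hw1, hwn⟩ := (hV w).mp hw
    refine eq_mul_primRoot_of_im_nonneg hn (norm_diskMobius hc hz1) hzn hwn ?_ fun v hv => ?_
    · intro h
      apply hne
      rw [← diskMobius_neg_diskMobius hc hz1.le, h, diskMobius_neg_diskMobius hc hw1.le]
    · have hv1 := norm_eq_one_of_pow (by omega) hμ hv
      have hv2 := norm_diskMobius hc' hv1
      have hv3 := diskMobius_diskMobius_neg hc hv1.le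
      have := hall (diskMobius (-c) v) ((hV _).mpr ⟨hv2, by rw [hv3, hv]⟩)
      rwa [← im_conj_mul_diskMobius_nonneg_iff hc hz1 hw1 hv2, hv3] at this
  · rintro ⟨hz, hw, hzw⟩
    obtain ⟨hz1, hzn⟩ := (hV z).mp hz
    obtain ⟨hw1, hwn⟩ := (hV w).mp hw
    refine ⟨hz, hw, ?_, fun v hv => ?_⟩
    · rintro rfl
      have h1 := norm_diskMobius hc hz1
      have h0 : diskMobius c z ≠ 0 := by
        intro h; rw [h] at h1; simp at h1
      exact (isPrimitiveRoot_primRoot (by omega)).ne_one (by omega) (mul_eq_left₀ h0 |>.mp hzw.symm)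
    · obtain ⟨hv1, hvn⟩ := (hV v).mp hv
      rw [← im_conj_mul_diskMobius_nonneg_iff hc hz1 hw1 hv1, hzw]
      exact im_conj_primRoot_nonneg hn (norm_diskMobius hc hz1) hzn hvn

theorem normSq_projNum_div {c z : ℂ} (hc : ‖c‖ < 1) (hz : ‖z‖ ≤ 1) (δ : ℝ) :
    Complex.normSq (projNum c z / projDenom c z) =
      1 - δ + conicForm δ c z / projDenom c z ^ 2 := by
  have h := projDenom_sq_sub_normSq_projNum c z
  have hL := (projDenom_pos hc hz).ne'
  rw [Complex.normSq_div, Complex.normSq_ofReal, conicForm, ← h]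
  field_simp
  ring

/-- The inverse projective map has parameter `-c` and agrees with `diskMobius (-c)` on the unit
circle. -/
theorem mem_convexHull_of_mem_convexHull_projMap {c p : ℂ} (hc : ‖c‖ < 1) (hp : ‖p‖ ≤ 1)
    {S : Set ℂ} (hS : ∀ u ∈ S, ‖u‖ = 1)
    (h : projNum c p / projDenom c p ∈ convexHull ℝ S) :
    p ∈ convexHull ℝ (diskMobius (-c) '' S) := by
  have hc' : ‖-c‖ < 1 := by rwa [norm_neg]
  have h1 := convexHull_projMap (c := -c) (fun u hu => projDenom_pos hc' (hS u hu).le) h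
  rwa [projMap_neg_projMap hc hp,
    Set.image_congr fun u hu => projNum_div_projDenom hc' (hS u hu)] at h1

theorem isBlaschkeCurve_conicForm {n : ℕ} (hn : 2 ≤ n) {c : ℂ} (hc : ‖c‖ < 1) {B : ℂ → ℂ}
    (hB : ∀ z, ‖z‖ = 1 → ‖B z‖ = 1)
    (hfib : ∀ l, ‖l‖ = 1 → ∃ μ : ℂ, ‖μ‖ = 1 ∧ ∀ z, ‖z‖ = 1 → (B z = l ↔ diskMobius c z ^ n = μ)) :
    IsBlaschkeCurve B {z | conicForm (Real.sin (Real.pi / n) ^ 2) c z = 0} := by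
  have hc' : ‖-c‖ < 1 := by rwa [norm_neg]
  have hpi := Real.pi_pos
  have hn' : (2 : ℝ) ≤ n := by exact_mod_cast hn
  have hle : Real.pi / n ≤ Real.pi / 2 := by gcongr
  have hsin : 0 < Real.sin (Real.pi / n) :=
    Real.sin_pos_of_pos_of_lt_pi (by positivity) (by linarith)
  have hcos : 0 ≤ Real.cos (Real.pi / n) :=
    Real.cos_nonneg_of_neg_pi_div_two_le_of_le (by linarith [div_pos hpi (by linarith : 0 < (n:ℝ))])
      hle
  have hsc := Real.sin_sq_add_cos_sq (Real.pi / n)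
  have hroot := normSq_primRoot_sub_one n
  set δ := Real.sin (Real.pi / n) ^ 2 with hδe
  have hδ : 0 < δ := by positivity
  have hcurve : ∀ p, conicForm δ c p = 0 → ‖p‖ < 1 ∧
      Complex.normSq (projNum c p / projDenom c p) = Real.cos (Real.pi / n) ^ 2 := by
    intro p hp
    have h1 := norm_lt_one_of_conicForm_nonpos hδ hc hp.le
    refine ⟨h1, ?_⟩
    rw [normSq_projNum_div hc h1.le δ, hp]
    linear_combination -hsc
  have hside : ∀ l, ‖l‖ = 1 → ∀ z w, IsPolygonSide (circleFiber B l) z w →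
      ∃ p, SegmentTangentAt {z | conicForm δ c z = 0} z w p := by
    intro l hl z w hzw
    obtain ⟨μ, hμ, hiff⟩ := hfib l hl
    obtain ⟨⟨hz, -⟩, ⟨hw, -⟩, he⟩ := (isPolygonSide_iff hn hc hμ fun z =>
      and_congr_right fun hz => hiff z hz).mp hzw
    refine exists_segmentTangentAt hδ hc hz hw ?_
    rw [he, ← mul_one_sub, Complex.normSq_mul, normSq_eq_one (norm_diskMobius hc hz), one_mul,
      ← neg_sub, Complex.normSq_neg, hroot]
  refine ⟨⟨{z | conicForm δ c z ≤ 0}, ?_, isCompact_conicForm_nonpos hδ.le hc,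
    convex_conicForm_nonpos hδ.le c, (frontier_conicForm_nonpos hδ.le hc).symm⟩, ?_, ?_, hside, ?_⟩
  · refine ⟨(2 / (1 + Complex.normSq c) : ℝ) * c, ?_⟩
    change conicForm δ c _ ≤ 0
    rw [conicForm_center]
    have h1 : δ - 1 ≤ 0 := by nlinarith
    exact div_nonpos_of_nonpos_of_nonneg
      (mul_nonpos_of_nonpos_of_nonneg h1 (by positivity)) (by positivity)
  · intro p hp
    exact mem_ball_zero_iff.mpr (hcurve p hp).1
  · intro l hl p hp
    obtain ⟨hp1, hq⟩ := hcurve p hp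
    obtain ⟨μ, hμ, hiff⟩ := hfib l hl
    have hq' : ‖projNum c p / projDenom c p‖ ≤ Real.cos (Real.pi / n) := by
      rw [Complex.normSq_eq_norm_sq] at hq
      exact le_of_sq_le_sq hq.le hcos
    have h1 := mem_convexHull_of_norm_le_cos (by omega) hμ hq'
    have h2 := mem_convexHull_of_mem_convexHull_projMap hc hp1.le
      (fun u hu => norm_eq_one_of_pow (by omega) hμ hu) h1
    refine convexHull_mono ?_ h2
    rintro _ ⟨u, hu, rfl⟩
    have hu1 := norm_eq_one_of_pow (by omega) hμ hu
    have hz := norm_diskMobius hc' hu1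
    exact ⟨hz, (hiff _ hz).mpr (by rw [diskMobius_diskMobius_neg hc hu1.le]; exact hu)⟩
  · intro p hp
    obtain ⟨hp1, hq⟩ := hcurve p hp
    obtain ⟨u, hu, hseg⟩ := exists_mem_segment_primRoot hq
    have hu' : ‖u * primRoot n‖ = 1 := by rw [norm_mul, hu, norm_primRoot, one_mul]
    have hz := norm_diskMobius hc' hu
    have hw := norm_diskMobius hc' hu'
    have hφz := diskMobius_diskMobius_neg hc hu.le
    have hφw := diskMobius_diskMobius_neg hc hu'.le
    have hpseg : p ∈ segment ℝ (diskMobius (-c) u) (diskMobius (-c) (u * primRoot n)) := by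
      rw [← convexHull_pair] at hseg
      have := mem_convexHull_of_mem_convexHull_projMap hc hp1.le (by
        rintro v (rfl | rfl)
        exacts [hu, hu']) hseg
      rwa [Set.image_pair, convexHull_pair] at this
    have hl := hB _ hz
    obtain ⟨μ, hμ, hiff⟩ := hfib _ hl
    have hzμ := (hiff _ hz).mp rfl
    have hpoly : IsPolygonSide (circleFiber B (B (diskMobius (-c) u))) (diskMobius (-c) u)
        (diskMobius (-c) (u * primRoot n)) := by
      refine (isPolygonSide_iff hn hc hμ fun z => and_congr_right fun hz => hiff z hz).mpr
        ⟨⟨hz, rfl⟩, ⟨hw, (hiff _ hw).mpr ?_⟩, by rw [hφz, hφw]⟩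
      rw [hφw, mul_pow, (isPrimitiveRoot_primRoot (by omega)).pow_eq_one, mul_one, ← hzμ, hφz]
    refine ⟨_, hl, _, _, hpoly, ?_⟩
    -- The side meets the conic only at its tangency point, and `p` lies on both.
    obtain ⟨p', hp'⟩ := hside _ hl _ _ hpoly
    have : p ∈ ({p'} : Set ℂ) := hp'.1 ▸ ⟨hp, hpseg⟩
    rwa [Set.mem_singleton_iff.mp this]

theorem proposition4p8 (n : ℕ) (γ : ℂ) (hγ : ‖γ‖ = 1) (a : Fin n → ℂ) (ha : ∀ j, ‖a j‖ < 1)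
    (hcrit : ∃! w : ℂ, w ∈ criticalValues (blaschkeProduct γ a)) :
    ∃ C : Set ℂ, IsBlaschkeCurve (blaschkeProduct γ a) C ∧
      ((n = 2 ∧ ∃ p : ℂ, C = {p}) ∨ (3 ≤ n ∧ IsEllipse C)) := by
  obtain ⟨hn, c, hc, hfib⟩ := exists_fiber_iff_pow hγ ha hcrit
  refine ⟨_, isBlaschkeCurve_conicForm hn hc (fun z hz => norm_blaschkeProduct_eq_one hγ ha hz) hfib,
    ?_⟩
  rcases hn.eq_or_lt with rfl | hn3
  · have h1 : Real.sin (Real.pi / (2 : ℕ)) ^ 2 = 1 := by simp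
    rw [h1]
    refine Or.inl ⟨rfl, _, conicForm_zero_set_of_grad zero_le_one hc ?_ (conicGrad_center c)⟩
    rw [conicForm_center, sub_self, zero_mul, zero_div]
  · refine Or.inr ⟨hn3, isEllipse_conicForm (sq_nonneg _) ?_ hc⟩
    have hn' : (2 : ℝ) < n := by exact_mod_cast hn3
    have hcos : 0 < Real.cos (Real.pi / n) := by
      have h0 : 0 < Real.pi / n := div_pos Real.pi_pos (by linarith)
      refine Real.cos_pos_of_mem_Ioo ⟨by linarith [Real.pi_pos], ?_⟩
      exact div_lt_div_of_pos_left Real.pi_pos two_pos hn'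
    have := Real.sin_sq_add_cos_sq (Real.pi / n)
    nlinarith [sq_pos_of_pos hcos]
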